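/- Let $A\ge 0$, $B>0$, $\alpha>0$ be real numbers, let $\mathbb D=\{z\in\mathbb C:|z|<1\}$, put $$\phi(z)=(1-|z|^2)^A\exp\!\left(\frac{-B}{(1-|z|^2)^\alpha}\right)\qquad(z\in\mathbb D),$$ and let $$\Omega=\{(z_1,z_2)\in\mathbb C^2 : z_1\in\mathbb D,\ |z_2|<\phi(z_1)\}.$$ Then $\Omega$ is a bounded pseudoconvex domain in $\mathbb C^2$ (an open connected set with a continuous plurisubharmonic exhaustion function), and it is complete Reinhardt. Let $\sigma_E$ be the Euclidean surface measure on the topological boundary $b\Omega$; it is given by the parametrization $(z,\theta)\mapsto(z,\phi(z)e^{i\theta})$ of the boundary by $\mathbb D\times(0,2\pi)$, up to null sets. Let $H^2(b\Omega)$ be the closure in $L^2(b\Omega,\sigma_E)$ of the (boundary values of) functions that are holomorphic in $\Omega$ and continuous on $\overline\Omega$, and let the Szegő projection $\mathbf S_\Omega$ be the orthogonal projection of $L^2(b\Omega,\sigma_E)$ onto $H^2(b\Omega)$. Then for every $p\in[1,\infty]$, the operator $\mathbf S_\Omega$ is bounded on $L^p(b\Omega,\sigma_E)$, i.e. there is a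 finite constant $C$ with $\|\mathbf S_\Omega f\|_{L^p}\le C\|f\|_{L^p}$ for all $f\in L^2\cap L^p(b\Omega,\sigma_E)$, if and only if $p=2$. -/

import Mathlib

open MeasureTheory Metric
open scoped ENNReal NNReal

noncomputable section

namespace SzegoIrregularity

/-- The profile `φ(z) = (1 - |z|²)^A exp(-B / (1 - |z|²)^α)`; it is only used for `|z| < 1`. -/
def profile (A B α : ℝ) (z : ℂ) : ℝ :=
  (1 - ‖z‖ ^ 2) ^ A * Real.exp (-B / (1 - ‖z‖ ^ 2) ^ α)

/-- The domain `Ω = {(z₁, z₂) : |z₁| < 1, |z₂| < φ(z₁)}` in `ℂ²`. -/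
def reinhardtDomain (A B α : ℝ) : Set (ℂ × ℂ) :=
  {w | ‖w.1‖ < 1 ∧ ‖w.2‖ < profile A B α w.1}

/-- `U` is a complete Reinhardt set: with `z` it contains the closed polydisc
`{w : |w₁| ≤ |z₁|, |w₂| ≤ |z₂|}`. -/
def IsCompleteReinhardt (U : Set (ℂ × ℂ)) : Prop :=
  ∀ z ∈ U, ∀ w : ℂ × ℂ, ‖w.1‖ ≤ ‖z.1‖ → ‖w.2‖ ≤ ‖z.2‖ → w ∈ U

/-- A continuous real function on `U` is plurisubharmonic if it satisfies the sub-mean value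
inequality on every closed (affinely embedded) complex disc contained in `U`. -/
def IsContinuousPlurisubharmonicOn (u : ℂ × ℂ → ℝ) (U : Set (ℂ × ℂ)) : Prop :=
  ContinuousOn u U ∧
    ∀ a b : ℂ × ℂ, (∀ ζ : ℂ, ‖ζ‖ ≤ 1 → a + ζ • b ∈ U) →
      u a ≤ Real.circleAverage (fun ζ : ℂ => u (a + ζ • b)) 0 1

/-- An open set is pseudoconvex if it carries a continuous plurisubharmonic exhaustion function. -/
def IsPseudoconvex (U : Set (ℂ × ℂ)) : Prop :=
  IsOpen U ∧ ∃ u : ℂ × ℂ → ℝ, IsContinuousPlurisubharmonicOn u U ∧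
    ∀ c : ℝ, IsCompact {z | z ∈ U ∧ u z ≤ c}

/-- The real Euclidean inner product `Re (u₁ v̄₁ + u₂ v̄₂)` on `ℂ² = ℝ⁴`. (The instance norm of
`ℂ × ℂ` is the maximum norm, and is used for topology and differentiability only.) -/
def euclideanInner (u v : ℂ × ℂ) : ℝ := inner ℝ u.1 v.1 + inner ℝ u.2 v.2

/-- The volume distortion `√det(⟨∂ᵢΨ, ∂ⱼΨ⟩)` of a map `Ψ` from `ℂ × ℝ = ℝ³` to `ℂ² = ℝ⁴`. -/
def gramJacobian (Ψ : ℂ × ℝ → ℂ × ℂ) (x : ℂ × ℝ) : ℝ :=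
  let e : Fin 3 → ℂ × ℝ := ![(1, 0), (Complex.I, 0), (0, 1)]
  Real.sqrt (Matrix.det (Matrix.of fun i j =>
    euclideanInner (fderiv ℝ Ψ x (e i)) (fderiv ℝ Ψ x (e j))))

/-- The Euclidean surface measure of the hypersurface parametrized by `Ψ` on the parameter
set `s`. -/
def parametrizedSurfaceMeasure (s : Set (ℂ × ℝ)) (Ψ : ℂ × ℝ → ℂ × ℂ) : Measure (ℂ × ℂ) :=
  ((volume.restrict s).withDensity fun x => ENNReal.ofReal (gramJacobian Ψ x)).map Ψ

/-- The parametrization `(z, θ) ↦ (z, φ(z) e^{iθ})` of the boundary of the domain. -/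
def boundaryParam (A B α : ℝ) (x : ℂ × ℝ) : ℂ × ℂ :=
  (x.1, profile A B α x.1 * Complex.exp (Complex.I * x.2))

theorem profile_pos (A B α : ℝ) {z : ℂ} (hz : ‖z‖ < 1) : 0 < profile A B α z := by
  have : 0 < 1 - ‖z‖ ^ 2 := by nlinarith [norm_nonneg z]
  exact mul_pos (Real.rpow_pos_of_pos this _) (Real.exp_pos _)

theorem continuousOn_profile (A B α : ℝ) : ContinuousOn (profile A B α) (ball 0 1) := by
  have h : ∀ z ∈ ball (0 : ℂ) 1, 0 < 1 - ‖z‖ ^ 2 := fun z hz => by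
    have : ‖z‖ < 1 := by simpa using hz
    nlinarith [norm_nonneg z]
  have h1 : ContinuousOn (fun z : ℂ => 1 - ‖z‖ ^ 2) (ball 0 1) := by fun_prop
  refine (h1.rpow_const fun z hz => Or.inl (h z hz).ne').mul ?_
  refine Real.continuous_exp.comp_continuousOn ?_
  exact continuousOn_const.div (h1.rpow_const fun z hz => Or.inl (h z hz).ne')
    fun z hz => (Real.rpow_pos_of_pos (h z hz) _).ne'

theorem profile_le {A B α : ℝ} (hA : 0 ≤ A) (hB : 0 < B) {z : ℂ} (hz : ‖z‖ < 1) :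
    profile A B α z ≤ B⁻¹ * (1 - ‖z‖ ^ 2) ^ α := by
  have h : 0 < 1 - ‖z‖ ^ 2 := by nlinarith [norm_nonneg z]
  have h' : 1 - ‖z‖ ^ 2 ≤ 1 := by nlinarith [norm_nonneg z]
  have hp : 0 < (1 - ‖z‖ ^ 2) ^ α := Real.rpow_pos_of_pos h _
  have h1 : (1 - ‖z‖ ^ 2) ^ A ≤ 1 := Real.rpow_le_one h.le h' hA
  have hq : 0 < B / (1 - ‖z‖ ^ 2) ^ α := div_pos hB hp
  have h2 : Real.exp (-B / (1 - ‖z‖ ^ 2) ^ α) ≤ B⁻¹ * (1 - ‖z‖ ^ 2) ^ α := by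
    rw [neg_div, Real.exp_neg]
    have h3 := Real.add_one_le_exp (B / (1 - ‖z‖ ^ 2) ^ α)
    calc _ ≤ (B / (1 - ‖z‖ ^ 2) ^ α)⁻¹ := by gcongr; linarith
      _ = _ := by rw [inv_div, div_eq_inv_mul]
  calc profile A B α z ≤ 1 * Real.exp (-B / (1 - ‖z‖ ^ 2) ^ α) := by
        unfold profile; gcongr
    _ ≤ _ := by rwa [one_mul]

theorem isOpen_reinhardtDomain (A B α : ℝ) : IsOpen (reinhardtDomain A B α) := by
  have h1 : IsOpen {w : ℂ × ℂ | ‖w.1‖ < 1} := isOpen_lt (by fun_prop) continuous_const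
  have h2 : ContinuousOn (fun w : ℂ × ℂ => profile A B α w.1 - ‖w.2‖) {w | ‖w.1‖ < 1} :=
    ((continuousOn_profile A B α).comp continuousOn_fst fun w hw => by simpa using hw).sub
      (by fun_prop)
  have := h2.isOpen_inter_preimage h1 (isOpen_Ioi (a := (0 : ℝ)))
  convert this using 1
  ext w
  simp [reinhardtDomain]

/-- The topological boundary of the domain is the image of the parametrization together with the
circle `|z₁| = 1, z₂ = 0`. -/
theorem frontier_reinhardtDomain {A B α : ℝ} (hA : 0 ≤ A) (hB : 0 < B) (hα : 0 < α) :
    frontier (reinhardtDomain A B α) =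
      boundaryParam A B α '' (ball (0 : ℂ) 1 ×ˢ Set.Ico 0 (2 * Real.pi)) ∪
        sphere (0 : ℂ) 1 ×ˢ {0} := by
  rw [(isOpen_reinhardtDomain A B α).frontier_eq]
  ext ⟨z, w⟩
  constructor
  · rintro ⟨hc, hn⟩
    obtain ⟨s, hs, hlim⟩ := mem_closure_iff_seq_limit.1 hc
    have l1 : Filter.Tendsto (fun n => (s n).1) Filter.atTop (nhds z) :=
      (continuous_fst.tendsto _).comp hlim
    have l2 : Filter.Tendsto (fun n => (s n).2) Filter.atTop (nhds w) :=
      (continuous_snd.tendsto _).comp hlim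
    have hz : ‖z‖ ≤ 1 := le_of_tendsto l1.norm (Filter.Eventually.of_forall fun n => (hs n).1.le)
    rcases hz.lt_or_eq with hz | hz
    · left
      have hzb : z ∈ ball (0 : ℂ) 1 := by simpa using hz
      have l3 := ((continuousOn_profile A B α).continuousAt
        (isOpen_ball.mem_nhds hzb)).tendsto.comp l1
      have hw : ‖w‖ ≤ profile A B α z :=
        le_of_tendsto_of_tendsto' l2.norm l3 fun n => (hs n).2.le
      have hw' : ‖w‖ = profile A B α z := by
        by_contra h
        exact hn ⟨hz, lt_of_le_of_ne hw h⟩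
      refine ⟨(z, toIcoMod Real.two_pi_pos 0 w.arg), ⟨hzb, ?_⟩, ?_⟩
      · simpa using toIcoMod_mem_Ico Real.two_pi_pos 0 w.arg
      · have hh : Complex.exp (Complex.I * (toIcoMod Real.two_pi_pos 0 w.arg : ℝ)) =
            Complex.exp (w.arg * Complex.I) := by
          rw [toIcoMod, Complex.exp_eq_exp_iff_exists_int]
          refine ⟨-toIcoDiv Real.two_pi_pos 0 w.arg, ?_⟩
          push_cast [zsmul_eq_mul]
          ring
        simp only [boundaryParam]
        rw [hh, ← hw', Complex.norm_mul_exp_arg_mul_I]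
    · right
      have l3 : Filter.Tendsto (fun n => B⁻¹ * (1 - ‖(s n).1‖ ^ 2) ^ α) Filter.atTop (nhds 0) := by
        have : Filter.Tendsto (fun n => B⁻¹ * (1 - ‖(s n).1‖ ^ 2) ^ α) Filter.atTop
            (nhds (B⁻¹ * (1 - ‖z‖ ^ 2) ^ α)) :=
          (((l1.norm.pow 2).const_sub 1).rpow_const (Or.inr hα.le)).const_mul _
        simpa [hz, Real.zero_rpow hα.ne'] using this
      have hw : ‖w‖ ≤ 0 := le_of_tendsto_of_tendsto' l2.norm l3 fun n =>
        (hs n).2.le.trans (profile_le hA hB (hs n).1)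
      simpa [hz] using hw
  · have : (nhdsWithin 1 (Set.Ico (0 : ℝ) 1)).NeBot := by
      rw [← mem_closure_iff_nhdsWithin_neBot, closure_Ico zero_ne_one]; simp
    have hr : ∀ {r : ℝ}, r ∈ Set.Ico (0 : ℝ) 1 → |r| < 1 := fun h => by
      rw [abs_of_nonneg h.1]; exact h.2
    rintro (⟨⟨x, θ⟩, ⟨hx, -⟩, h⟩ | ⟨hz, hw⟩)
    · have hx' : ‖x‖ < 1 := by simpa using hx
      obtain ⟨rfl, rfl⟩ : x = z ∧ _ = w := Prod.mk.inj h
      have hp := profile_pos A B α hx'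
      have hnorm : ‖(profile A B α x : ℂ) * Complex.exp (Complex.I * θ)‖ = profile A B α x := by
        rw [norm_mul, mul_comm Complex.I, Complex.norm_exp_ofReal_mul_I, mul_one,
          Complex.norm_real, Real.norm_of_nonneg hp.le]
      refine ⟨?_, fun hm => hm.2.ne hnorm⟩
      refine mem_closure_of_tendsto (b := nhdsWithin 1 (Set.Ico (0 : ℝ) 1)) (f := fun r : ℝ =>
        (x, (r : ℂ) * ((profile A B α x : ℂ) * Complex.exp (Complex.I * θ)))) ?_ ?_
      · refine Filter.Tendsto.mono_left ?_ nhdsWithin_le_nhds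
        exact Continuous.tendsto' (by fun_prop) _ _ (by simp)
      · filter_upwards [self_mem_nhdsWithin] with r hr'
        refine ⟨hx', ?_⟩
        rw [norm_mul, hnorm, Complex.norm_real, Real.norm_eq_abs]
        exact mul_lt_of_lt_one_left hp (hr hr')
    · obtain rfl : w = 0 := hw
      have hz' : ‖z‖ = 1 := by simpa using hz
      refine ⟨?_, fun hm => hm.1.ne hz'⟩
      refine mem_closure_of_tendsto (b := nhdsWithin 1 (Set.Ico (0 : ℝ) 1)) (f := fun r : ℝ =>
        ((r : ℂ) * z, (0 : ℂ))) ?_ ?_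
      · refine Filter.Tendsto.mono_left ?_ nhdsWithin_le_nhds
        exact Continuous.tendsto' (by fun_prop) _ _ (by simp)
      · filter_upwards [self_mem_nhdsWithin] with r hr'
        have h1 : ‖(r : ℂ) * z‖ < 1 := by
          rw [norm_mul, hz', mul_one, Complex.norm_real, Real.norm_eq_abs]
          exact hr hr'
        exact ⟨h1, by simpa using profile_pos A B α h1⟩

/-- The Euclidean surface measure `dσ_E` on the topological boundary `bΩ`. The parametrization is
injective on the disc times `(0, 2π)`, and its image is all of `bΩ` except the surface `θ = 0` and
the circle `|z₁| = 1, z₂ = 0`, which are null sets of three-dimensional measure. -/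
def surfaceMeasure (A B α : ℝ) : Measure (ℂ × ℂ) :=
  parametrizedSurfaceMeasure (ball (0 : ℂ) 1 ×ˢ Set.Ioo 0 (2 * Real.pi)) (boundaryParam A B α)

/-- The (classes of) boundary values of functions that are holomorphic in `U` and continuous on
the closure of `U`, inside `L²(σ)` for a measure `σ` on the boundary of `U`. -/
def holomorphicBoundaryValues (U : Set (ℂ × ℂ)) (σ : Measure (ℂ × ℂ)) :
    Submodule ℂ (Lp ℂ 2 σ) where
  carrier := {g | ∃ F : ℂ × ℂ → ℂ, DifferentiableOn ℂ F U ∧ ContinuousOn F (closure U) ∧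
    g =ᵐ[σ] F}
  zero_mem' := ⟨fun _ => 0, differentiableOn_const 0, continuousOn_const, Lp.coeFn_zero _ _ _⟩
  add_mem' := by
    rintro g h ⟨F, hF, hF', hgF⟩ ⟨G, hG, hG', hhG⟩
    exact ⟨F + G, hF.add hG, hF'.add hG', (Lp.coeFn_add g h).trans (hgF.add hhG)⟩
  smul_mem' := by
    rintro c g ⟨F, hF, hF', hgF⟩
    exact ⟨c • F, hF.const_smul c, hF'.const_smul c,
      (Lp.coeFn_smul c g).trans (hgF.const_smul c)⟩

/-- The Hardy space `H²(bU)`: the closure in `L²(σ)` of the holomorphic functions that are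
continuous up to the boundary. -/
def hardySpace (U : Set (ℂ × ℂ)) (σ : Measure (ℂ × ℂ)) : Submodule ℂ (Lp ℂ 2 σ) :=
  (holomorphicBoundaryValues U σ).topologicalClosure

instance (U : Set (ℂ × ℂ)) (σ : Measure (ℂ × ℂ)) : (hardySpace U σ).HasOrthogonalProjection :=
  inferInstanceAs (holomorphicBoundaryValues U σ).topologicalClosure.HasOrthogonalProjection

/-- The Szegő projection: the orthogonal projection of `L²(σ)` onto the Hardy space. -/
def szegoProjection (U : Set (ℂ × ℂ)) (σ : Measure (ℂ × ℂ)) : Lp ℂ 2 σ →L[ℂ] Lp ℂ 2 σ :=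
  (hardySpace U σ).starProjection

/-- An operator on `L²(σ)` is bounded on `L^p(σ)` if it maps `L² ∩ L^p` to `L^p` with a norm
estimate. -/
def IsBoundedOnLp {σ : Measure (ℂ × ℂ)} (T : Lp ℂ 2 σ →L[ℂ] Lp ℂ 2 σ) (p : ℝ≥0∞) : Prop :=
  ∃ C : ℝ≥0, ∀ f : Lp ℂ 2 σ, MemLp f p σ → eLpNorm (T f) p σ ≤ C * eLpNorm f p σ

end SzegoIrregularity

end

noncomputable section

namespace SzegoIrregularity

/-! The geometry is elementary except for pseudoconvexity. There the functions that matter, `-log (1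
- |z|²)` and `-log φ`, touch from above the real part of a holomorphic function at each point. The
chosen exhaustion inherits such supports, and the mean value property of the support gives the
sub-mean value inequality without any second derivatives.

For the projection, the rotational symmetries reduce everything to one-variable moments. If `k` is
radial, `z₁ⁿ k(|z₁|)` projects to `c z₁ⁿ`, where `c` is the quotient of `∫ |z₁|²ⁿ k` by `∫ |z₁|²ⁿ`
(`szegoProjection_pow_mul_radial`). Write `M(t) = ∫ |z₁|ᵗ dσ` and `β = α/(1+α)`. Because `φ`
vanishes exponentially at the rim, Laplace's method gives `-log M(t) ~ c₀ t^β` with `c₀ > 0`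
(`exists_tendsto_neg_log_moment`), and `0 < β < 1`.

For `1 < p < ∞` with conjugate exponent `q`, the test function of modulus `|z₁|^{n(q-1)}` turns an
`Lᵖ` bound into `M(pn)^{1/p} M(qn)^{1/q} ≤ C M(2n)` for all `n ≥ 1`. Taking logarithms and dividing
by `n^β` yields `2^β ≤ p^{β-1} + q^{β-1}`. Strict concavity of `x^{1-β}` at `1/p` and `1/q`, whose
midpoint is `1/2`, forbids this unless `p = 2` (`rpow_sub_one_add_rpow_sub_one_lt`). At `p = ∞` and
`p = 1` suitable tests give `M(n) ≤ 2C M(2n)`, which contradicts `1 < 2^β`. -/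

/-! ### Elementary geometry of the domain -/

theorem one_sub_norm_sq_pos {z : ℂ} (hz : ‖z‖ < 1) : 0 < 1 - ‖z‖ ^ 2 := by
  nlinarith [norm_nonneg z]

theorem profile_anti {A B α : ℝ} (hA : 0 ≤ A) (hB : 0 < B) (hα : 0 < α) {z w : ℂ}
    (hwz : ‖w‖ ≤ ‖z‖) (hz : ‖z‖ < 1) : profile A B α z ≤ profile A B α w := by
  have h := one_sub_norm_sq_pos hz
  have hle : 1 - ‖z‖ ^ 2 ≤ 1 - ‖w‖ ^ 2 := by gcongr
  unfold profile
  have h1 : (1 - ‖z‖ ^ 2) ^ A ≤ (1 - ‖w‖ ^ 2) ^ A := Real.rpow_le_rpow h.le hle hA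
  have h2 : (1 - ‖z‖ ^ 2) ^ α ≤ (1 - ‖w‖ ^ 2) ^ α := Real.rpow_le_rpow h.le hle hα.le
  have h3 : 0 < (1 - ‖z‖ ^ 2) ^ α := Real.rpow_pos_of_pos h _
  have h4 : -B / (1 - ‖z‖ ^ 2) ^ α ≤ -B / (1 - ‖w‖ ^ 2) ^ α := by
    rw [neg_div, neg_div, neg_le_neg_iff]
    gcongr
  have h5 : 0 ≤ (1 - ‖w‖ ^ 2) ^ A := Real.rpow_nonneg (h.le.trans hle) _
  gcongr

theorem isCompleteReinhardt_reinhardtDomain {A B α : ℝ} (hA : 0 ≤ A) (hB : 0 < B) (hα : 0 < α) :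
    IsCompleteReinhardt (reinhardtDomain A B α) := fun _ hz _ h1 h2 =>
  ⟨h1.trans_lt hz.1, h2.trans_lt (hz.2.trans_le (profile_anti hA hB hα h1 hz.1))⟩

/-- Multiplication by a real number in `[0, 1]` shrinks both moduli, so the set is star-shaped about
the origin. -/
theorem IsCompleteReinhardt.isConnected {U : Set (ℂ × ℂ)} (hU : IsCompleteReinhardt U)
    (hne : U.Nonempty) : IsConnected U := by
  obtain ⟨z, hz⟩ := hne
  have h0 : (0 : ℂ × ℂ) ∈ U := hU z hz 0 (by simp) (by simp)
  have hs : StarConvex ℝ (0 : ℂ × ℂ) U := by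
    rw [starConvex_zero_iff]
    intro x hx a ha ha'
    have key : ∀ y : ℂ, ‖a • y‖ ≤ ‖y‖ := fun y => by
      rw [norm_smul, Real.norm_of_nonneg ha]
      exact mul_le_of_le_one_left (norm_nonneg _) ha'
    exact hU x hx _ (key _) (key _)
  exact (hs.isPathConnected h0).isConnected

theorem zero_mem_reinhardtDomain (A B α : ℝ) : (0 : ℂ × ℂ) ∈ reinhardtDomain A B α :=
  ⟨by simp, by simpa using profile_pos A B α (z := 0) (by simp)⟩

theorem profile_le_inv {A B α : ℝ} (hA : 0 ≤ A) (hB : 0 < B) (hα : 0 < α) {z : ℂ}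
    (hz : ‖z‖ < 1) : profile A B α z ≤ B⁻¹ := by
  refine (profile_le hA hB hz).trans (mul_le_of_le_one_right (by positivity) ?_)
  exact Real.rpow_le_one (one_sub_norm_sq_pos hz).le (by nlinarith [norm_nonneg z]) hα.le

theorem isBounded_reinhardtDomain {A B α : ℝ} (hA : 0 ≤ A) (hB : 0 < B) (hα : 0 < α) :
    Bornology.IsBounded (reinhardtDomain A B α) := by
  refine (isBounded_closedBall (x := (0 : ℂ × ℂ)) (r := max 1 B⁻¹)).subset fun w hw => ?_
  rw [mem_closedBall_zero_iff]
  exact max_le_max hw.1.le (hw.2.le.trans (profile_le_inv hA hB hα hw.1))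

/-! ### Pseudoconvexity through holomorphic supports -/

/-- `-log (1 - |z|²)` is supported from below, at every point of the disc, by the real part of a
holomorphic function. -/
theorem exists_holomorphic_support (a : ℂ) (ha : ‖a‖ < 1) : ∃ l : ℂ → ℂ,
    DifferentiableOn ℂ l (ball 0 1) ∧ (∀ z ∈ ball (0 : ℂ) 1, (l z).re ≤ -Real.log (1 - ‖z‖ ^ 2)) ∧
      l a = (-Real.log (1 - ‖a‖ ^ 2) : ℝ) := by
  have ha' := one_sub_norm_sq_pos ha
  have hlt : ∀ z ∈ ball (0 : ℂ) 1, ‖(starRingEnd ℂ) a * z‖ < 1 := fun z hz => by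
    rw [norm_mul, RCLike.norm_conj]
    have : ‖z‖ < 1 := by simpa using hz
    nlinarith [norm_nonneg a, norm_nonneg z]
  have hre : ∀ z ∈ ball (0 : ℂ) 1, 0 < (1 - (starRingEnd ℂ) a * z).re := fun z hz => by
    have := (Complex.re_le_norm ((starRingEnd ℂ) a * z)).trans_lt (hlt z hz)
    rw [Complex.sub_re, Complex.one_re]
    linarith
  -- The support inequality is `(1 - |a|²)(1 - |z|²) ≤ |1 - āz|²`, whose two sides differ by `|a -
  -- z|²`. The principal logarithm is holomorphic here because `Re (1 - āz) > 0`.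
  refine ⟨fun z => Real.log (1 - ‖a‖ ^ 2) - 2 * Complex.log (1 - (starRingEnd ℂ) a * z),
    ?_, ?_, ?_⟩
  · refine (differentiableOn_const _).sub ((differentiableOn_const _).mul ?_)
    exact DifferentiableOn.clog (by fun_prop) fun z hz => Or.inl (hre z hz)
  · intro z hz
    have hz' := one_sub_norm_sq_pos (by simpa using hz : ‖z‖ < 1)
    have hne : 0 < ‖1 - (starRingEnd ℂ) a * z‖ := by
      rw [norm_pos_iff]; intro h; have := hre z hz; simp [h] at this
    have key : (1 - ‖a‖ ^ 2) * (1 - ‖z‖ ^ 2) ≤ ‖1 - (starRingEnd ℂ) a * z‖ ^ 2 := by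
      simp only [← Complex.normSq_eq_norm_sq, Complex.normSq_apply, Complex.sub_re, Complex.sub_im,
        Complex.mul_re, Complex.mul_im, Complex.conj_re, Complex.conj_im, Complex.one_re,
        Complex.one_im]
      nlinarith [sq_nonneg (a.re - z.re), sq_nonneg (a.im - z.im)]
    have h2 := Real.log_le_log (mul_pos ha' hz') key
    rw [Real.log_mul ha'.ne' hz'.ne', Real.log_pow] at h2
    have : (2 * Complex.log (1 - (starRingEnd ℂ) a * z)).re
        = 2 * Real.log ‖1 - (starRingEnd ℂ) a * z‖ := by
      rw [← Complex.log_re]; simp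
    rw [Complex.sub_re, this, Complex.ofReal_re]
    push_cast at h2
    linarith
  · have : 1 - (starRingEnd ℂ) a * a = ((1 - ‖a‖ ^ 2 : ℝ) : ℂ) := by
      rw [mul_comm, Complex.mul_conj, Complex.normSq_eq_norm_sq]; push_cast; ring
    simp only [this]
    rw [← Complex.ofReal_log ha'.le]
    push_cast
    ring

/-- The average of `Re F` over the circle is its value at the centre, where it dominates `u`; on the
circle `u` dominates it. -/
theorem le_circleAverage_of_holomorphic_support {u : ℂ → ℝ} {F : ℂ → ℂ}
    (hu : ContinuousOn u (sphere 0 1)) (hF : DiffContOnCl ℂ F (ball 0 1))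
    (hle : ∀ ζ ∈ sphere (0 : ℂ) 1, (F ζ).re ≤ u ζ) (h0 : u 0 ≤ (F 0).re) :
    u 0 ≤ Real.circleAverage u 0 1 := by
  have hFi : CircleIntegrable F 0 1 := by
    refine ContinuousOn.circleIntegrable zero_le_one (hF.continuousOn.mono ?_)
    rw [closure_ball _ one_ne_zero]
    exact sphere_subset_closedBall
  have h1 : Real.circleAverage F 0 1 = F 0 :=
    DiffContOnCl.circleAverage (by simpa using hF)
  have h2 : Real.circleAverage (fun ζ => (F ζ).re) 0 1 = (F 0).re := by
    rw [← h1]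
    exact (Complex.reCLM.circleAverage_comp_comm hFi)
  rw [← h2] at h0
  refine h0.trans (Real.circleAverage_mono ?_ (hu.circleIntegrable zero_le_one) ?_)
  · exact Complex.reCLM.continuous.comp_continuousOn (hF.continuousOn.mono (by
      rw [closure_ball _ one_ne_zero]; exact sphere_subset_closedBall)) |>.circleIntegrable
        zero_le_one
  · simpa using hle

/-- A continuous plurisubharmonic exhaustion of the domain. -/
def exhaustion (A B α : ℝ) (w : ℂ × ℂ) : ℝ :=
  (1 - ‖w.1‖ ^ 2)⁻¹ + (1 - (‖w.2‖ / profile A B α w.1) ^ 2)⁻¹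

theorem norm_div_profile_lt_one {A B α : ℝ} {w : ℂ × ℂ} (hw : w ∈ reinhardtDomain A B α) :
    ‖w.2‖ / profile A B α w.1 < 1 :=
  (div_lt_one (profile_pos A B α hw.1)).2 hw.2

theorem one_sub_sq_div_profile_pos {A B α : ℝ} {w : ℂ × ℂ} (hw : w ∈ reinhardtDomain A B α) :
    0 < 1 - (‖w.2‖ / profile A B α w.1) ^ 2 := by
  have h1 := norm_div_profile_lt_one hw
  have h2 : 0 ≤ ‖w.2‖ / profile A B α w.1 :=
    div_nonneg (norm_nonneg _) (profile_pos A B α hw.1).le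
  nlinarith

theorem continuousOn_exhaustion (A B α : ℝ) :
    ContinuousOn (exhaustion A B α) (reinhardtDomain A B α) := by
  have h1 : ContinuousOn (fun w : ℂ × ℂ => profile A B α w.1) (reinhardtDomain A B α) :=
    (continuousOn_profile A B α).comp continuousOn_fst fun w hw => by simpa using hw.1
  refine ContinuousOn.add (ContinuousOn.inv₀ (by fun_prop) fun w hw =>
    (one_sub_norm_sq_pos hw.1).ne') (ContinuousOn.inv₀ ?_ fun w hw =>
      (one_sub_sq_div_profile_pos hw).ne')
  exact continuousOn_const.sub ((ContinuousOn.div (by fun_prop) h1 fun w hw =>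
    (profile_pos A B α hw.1).ne').pow 2)

/-- Supports survive exponentiation: `Re e^{sl} ≤ |e^{sl}| = e^{s Re l}`. Contact is kept because
the support is real at the contact point, which is what `exp_mul_neg_log` records. -/
theorem exp_re_le_rpow {l : ℂ} {x s : ℝ} (hx : 0 < x) (hs : 0 ≤ s) (h : l.re ≤ -Real.log x) :
    (Complex.exp (s * l)).re ≤ x ^ (-s) := by
  refine (Complex.re_le_norm _).trans ?_
  rw [Complex.norm_exp, Real.rpow_def_of_pos hx, Real.exp_le_exp]
  simp only [Complex.mul_re, Complex.ofReal_re, Complex.ofReal_im, zero_mul, sub_zero]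
  nlinarith

theorem exp_mul_neg_log {x s : ℝ} (hx : 0 < x) :
    Complex.exp (s * ((-Real.log x : ℝ) : ℂ)) = (x ^ (-s) : ℝ) := by
  rw [Real.rpow_def_of_pos hx, Complex.ofReal_exp]
  congr 1
  push_cast
  ring

/-- `-log φ` is supported from below by the real part of a holomorphic function. -/
theorem exists_holomorphic_support_profile {A B α : ℝ} (hA : 0 ≤ A) (hB : 0 < B) (hα : 0 < α)
    (a : ℂ) (ha : ‖a‖ < 1) : ∃ H : ℂ → ℂ, DifferentiableOn ℂ H (ball 0 1) ∧
      (∀ z ∈ ball (0 : ℂ) 1, ‖Complex.exp (H z)‖ ≤ (profile A B α z)⁻¹) ∧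
      ‖Complex.exp (H a)‖ = (profile A B α a)⁻¹ := by
  obtain ⟨l, hl, hle, heq⟩ := exists_holomorphic_support a ha
  have hprof : ∀ z : ℂ, ‖z‖ < 1 → (profile A B α z)⁻¹ =
      Real.exp (A * -Real.log (1 - ‖z‖ ^ 2) + B * (1 - ‖z‖ ^ 2) ^ (-α)) := fun z hz => by
    have h := one_sub_norm_sq_pos hz
    rw [profile, Real.rpow_def_of_pos h A, ← Real.exp_add, ← Real.exp_neg, Real.rpow_neg h.le]
    congr 1
    ring
  -- This mirrors `-log φ = -A log (1 - |z|²) + B (1 - |z|²)^{-α}` term by term; `A, B ≥ 0`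
  -- preserves the inequalities.
  refine ⟨fun z => A * l z + B * Complex.exp (α * l z), ?_, ?_, ?_⟩
  · exact ((differentiableOn_const _).mul hl).add
      ((differentiableOn_const _).mul ((differentiableOn_const _).mul hl).cexp)
  · intro z hz
    have hz' : ‖z‖ < 1 := by simpa using hz
    rw [hprof z hz', Complex.norm_exp, Real.exp_le_exp, Complex.add_re, Complex.re_ofReal_mul,
      Complex.re_ofReal_mul]
    gcongr
    · exact hle z hz
    · exact exp_re_le_rpow (one_sub_norm_sq_pos hz') hα.le (hle z hz)
  · rw [hprof a ha, Complex.norm_exp, Complex.add_re, Complex.re_ofReal_mul,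
      Complex.re_ofReal_mul, heq, exp_mul_neg_log (one_sub_norm_sq_pos ha), Complex.ofReal_re,
      Complex.ofReal_re]

theorem isContinuousPlurisubharmonicOn_exhaustion {A B α : ℝ} (hA : 0 ≤ A) (hB : 0 < B)
    (hα : 0 < α) :
    IsContinuousPlurisubharmonicOn (exhaustion A B α) (reinhardtDomain A B α) := by
  refine ⟨continuousOn_exhaustion A B α, fun a b hab => ?_⟩
  have haU : a ∈ reinhardtDomain A B α := by simpa using hab 0 (by simp)
  obtain ⟨l, hl, hle, heq⟩ := exists_holomorphic_support a.1 haU.1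
  obtain ⟨H, hH, hHle, hHeq⟩ := exists_holomorphic_support_profile hA hB hα a.1 haU.1
  have hp := profile_pos A B α haU.1
  -- `g` is a holomorphic map of the domain into the unit disc with `|g| ≤ |w₂|/φ(w₁)` and equality
  -- at `a`. Pulling back the disc support at `g a` therefore supports the second term of the
  -- exhaustion.
  set g : ℂ × ℂ → ℂ := fun w => w.2 * Complex.exp (H w.1) with hg
  have hgle : ∀ w ∈ reinhardtDomain A B α, ‖g w‖ ≤ ‖w.2‖ / profile A B α w.1 := fun w hw => by
    rw [hg, norm_mul, div_eq_mul_inv]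
    gcongr
    exact hHle _ (by simpa using hw.1)
  have hg1 : ∀ w ∈ reinhardtDomain A B α, ‖g w‖ < 1 := fun w hw =>
    (hgle w hw).trans_lt (norm_div_profile_lt_one hw)
  have hga : ‖g a‖ = ‖a.2‖ / profile A B α a.1 := by
    rw [hg, norm_mul, div_eq_mul_inv, hHeq]
  obtain ⟨k, hk, hkle, hkeq⟩ := exists_holomorphic_support (g a) (hg1 a haU)
  set F : ℂ × ℂ → ℂ := fun w => Complex.exp ((1 : ℝ) * l w.1) + Complex.exp ((1 : ℝ) * k (g w))
  have hFd : DifferentiableOn ℂ F (reinhardtDomain A B α) := by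
    have h1 : Set.MapsTo (Prod.fst : ℂ × ℂ → ℂ) (reinhardtDomain A B α) (ball 0 1) :=
      fun w hw => by simpa using hw.1
    have hgd : DifferentiableOn ℂ g (reinhardtDomain A B α) :=
      differentiableOn_snd.mul (hH.comp differentiableOn_fst h1).cexp
    have hld := hl.comp differentiableOn_fst h1
    have hkd := hk.comp hgd fun w hw => by simpa using hg1 w hw
    exact ((differentiableOn_const _).mul hld).cexp.add ((differentiableOn_const _).mul hkd).cexp
  have hFle : ∀ w ∈ reinhardtDomain A B α, (F w).re ≤ exhaustion A B α w := fun w hw => by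
    have hg1' := hg1 w hw
    rw [Complex.add_re, exhaustion]
    refine add_le_add ?_ ?_
    · have := exp_re_le_rpow (one_sub_norm_sq_pos hw.1) zero_le_one (hle w.1 (by simpa using hw.1))
      rwa [Real.rpow_neg_one] at this
    · have := exp_re_le_rpow (one_sub_norm_sq_pos hg1') zero_le_one
        (hkle (g w) (by simpa using hg1'))
      rw [Real.rpow_neg_one] at this
      refine this.trans (inv_anti₀ (one_sub_sq_div_profile_pos hw) ?_)
      have := hgle w hw
      gcongr
  have hFa : exhaustion A B α a = (F a).re := by
    simp only [F]
    rw [Complex.add_re, exhaustion, heq, hkeq, exp_mul_neg_log (one_sub_norm_sq_pos haU.1),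
      exp_mul_neg_log (one_sub_norm_sq_pos (hg1 a haU)), Complex.ofReal_re, Complex.ofReal_re,
      Real.rpow_neg_one, Real.rpow_neg_one, hga]
  have hmaps : Set.MapsTo (fun ζ : ℂ => a + ζ • b) (closedBall 0 1) (reinhardtDomain A B α) :=
    fun ζ hζ => hab ζ (by simpa using hζ)
  have hd : DifferentiableOn ℂ (fun ζ : ℂ => F (a + ζ • b)) (closedBall 0 1) :=
    hFd.comp (f := fun ζ : ℂ => a + ζ • b) (by fun_prop) hmaps
  have := le_circleAverage_of_holomorphic_support (u := fun ζ => exhaustion A B α (a + ζ • b))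
    (F := fun ζ => F (a + ζ • b))
    (((continuousOn_exhaustion A B α).comp (by fun_prop) hmaps).mono sphere_subset_closedBall)
    (DifferentiableOn.diffContOnCl (by rwa [closure_ball (0 : ℂ) one_ne_zero]))
    (fun ζ hζ => hFle _ (hmaps (sphere_subset_closedBall hζ))) (by simp [hFa])
  simpa using this

theorem isPseudoconvex_reinhardtDomain {A B α : ℝ} (hA : 0 ≤ A) (hB : 0 < B) (hα : 0 < α) :
    IsPseudoconvex (reinhardtDomain A B α) := by
  refine ⟨isOpen_reinhardtDomain A B α, exhaustion A B α,
    isContinuousPlurisubharmonicOn_exhaustion hA hB hα, fun c => ?_⟩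
  rcases Set.eq_empty_or_nonempty {w | w ∈ reinhardtDomain A B α ∧ exhaustion A B α w ≤ c}
    with he | ⟨w₀, hw₀, hw₀c⟩
  · rw [he]; exact isCompact_empty
  have hle : ∀ w ∈ reinhardtDomain A B α, exhaustion A B α w ≤ c →
      (1 - ‖w.1‖ ^ 2)⁻¹ ≤ c ∧ (1 - (‖w.2‖ / profile A B α w.1) ^ 2)⁻¹ ≤ c := fun w hw h => by
    have h1 := inv_pos.2 (one_sub_norm_sq_pos hw.1)
    have h2 := inv_pos.2 (one_sub_sq_div_profile_pos hw)
    rw [exhaustion] at h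
    constructor <;> linarith
  have hc : 0 < c := (inv_pos.2 (one_sub_norm_sq_pos hw₀.1)).trans_le (hle w₀ hw₀ hw₀c).1
  have hc' : 0 < c⁻¹ := inv_pos.2 hc
  -- Both summands of the exhaustion are positive, so a value at most `c` bounds each by `c`, that
  -- is `|w₁| ≤ s` and `|w₂| ≤ s φ(w₁)`. These inequalities describe a continuous image of a product
  -- of closed discs.
  set s := Real.sqrt (1 - c⁻¹)
  have hs : s < 1 := (Real.sqrt_lt' one_pos).2 (by linarith)
  have hs0 : 0 ≤ s := Real.sqrt_nonneg _
  set f : ℂ × ℂ → ℂ × ℂ := fun w => (w.1, (s * profile A B α w.1 : ℝ) * w.2)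
  have hf : ContinuousOn f (closedBall 0 s ×ˢ closedBall 0 1) := by
    refine continuousOn_fst.prodMk (ContinuousOn.mul ?_ continuousOn_snd)
    refine Complex.continuous_ofReal.comp_continuousOn (continuousOn_const.mul ?_)
    refine (continuousOn_profile A B α).comp continuousOn_fst fun w hw => ?_
    exact closedBall_subset_ball hs hw.1
  set K := f '' (closedBall 0 s ×ˢ closedBall 0 1)
  have hK : IsCompact K :=
    ((isCompact_closedBall _ _).prod (isCompact_closedBall _ _)).image_of_continuousOn hf
  have hKU : K ⊆ reinhardtDomain A B α := by
    rintro _ ⟨w, ⟨hw1, hw2⟩, rfl⟩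
    have hw1' : ‖w.1‖ < 1 := by simpa using closedBall_subset_ball hs hw1
    have hp := profile_pos A B α hw1'
    refine ⟨hw1', ?_⟩
    rw [mem_closedBall_zero_iff] at hw2
    simp only [f]
    rw [norm_mul, Complex.norm_real, Real.norm_of_nonneg (mul_nonneg hs0 hp.le)]
    calc s * profile A B α w.1 * ‖w.2‖ ≤ s * profile A B α w.1 * 1 := by gcongr
      _ < profile A B α w.1 := by nlinarith
  have hcl : IsClosed (K ∩ exhaustion A B α ⁻¹' Set.Iic c) :=
    ((continuousOn_exhaustion A B α).mono hKU).preimage_isClosed_of_isClosed hK.isClosed isClosed_Iic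
  convert hK.of_isClosed_subset hcl Set.inter_subset_left
  ext w
  refine ⟨fun hw => ⟨?_, hw.2⟩, fun hw => ⟨hKU hw.1, hw.2⟩⟩
  have hp := profile_pos A B α hw.1.1
  obtain ⟨h1, h2⟩ := hle w hw.1 hw.2
  have h1 := (inv_le_comm₀ (one_sub_norm_sq_pos hw.1.1) hc).1 h1
  have h2 := (inv_le_comm₀ (one_sub_sq_div_profile_pos hw.1) hc).1 h2
  have h1 : ‖w.1‖ ≤ s := Real.le_sqrt_of_sq_le (by linarith)
  have h2 : ‖w.2‖ / profile A B α w.1 ≤ s := Real.le_sqrt_of_sq_le (by linarith)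
  rw [div_le_iff₀ hp] at h2
  refine ⟨(w.1, w.2 / (s * profile A B α w.1 : ℝ)), ⟨by simpa using h1, ?_⟩, ?_⟩
  · rw [mem_closedBall_zero_iff, norm_div, Complex.norm_real,
      Real.norm_of_nonneg (mul_nonneg hs0 hp.le)]
    exact div_le_one_of_le₀ h2 (mul_nonneg hs0 hp.le)
  · refine Prod.ext rfl ?_
    -- If `s = 0`, the preimage is built with a division by zero, but then `w₂ = 0` as well.
    rcases eq_or_ne s 0 with h | h
    · have : w.2 = 0 := by simpa [h] using h2
      simp [f, this]
    · have : ((s * profile A B α w.1 : ℝ) : ℂ) ≠ 0 := by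
        exact_mod_cast mul_ne_zero h hp.ne'
      exact mul_div_cancel₀ _ this
-- The density of the surface measure
-- The tangent vector in `θ` has length `|f|` and is orthogonal to the other two, whose Gram matrix
-- is the identity plus `∇f ∇fᵀ`. Hence the determinant is `f² (1 + |∇f|²)`.
theorem gramJacobian_rotation_graph {f : ℂ → ℝ} {z : ℂ} {f' : ℂ →L[ℝ] ℝ} (hf : HasFDerivAt f f' z)
    (θ : ℝ) : gramJacobian (fun x : ℂ × ℝ => (x.1, f x.1 * Complex.exp (Complex.I * x.2))) (z, θ) =
      |f z| * Real.sqrt (1 + f' 1 ^ 2 + f' Complex.I ^ 2) := by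
  have h1 : HasFDerivAt (fun x : ℂ × ℝ => (f x.1 : ℂ))
      (Complex.ofRealCLM ∘L f' ∘L ContinuousLinearMap.fst ℝ ℂ ℝ) (z, θ) :=
    Complex.ofRealCLM.hasFDerivAt.comp (z, θ)
      (HasFDerivAt.comp (z, θ) (f := Prod.fst) hf hasFDerivAt_fst)
  have h2 : HasFDerivAt (fun x : ℂ × ℝ => Complex.exp (Complex.I * x.2))
      (Complex.exp (Complex.I * θ) • Complex.I • (Complex.ofRealCLM ∘L
        ContinuousLinearMap.snd ℝ ℂ ℝ)) (z, θ) :=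
    HasFDerivAt.cexp (HasFDerivAt.const_mul
      (Complex.ofRealCLM.hasFDerivAt.comp (z, θ) hasFDerivAt_snd) Complex.I)
  have h3 : HasFDerivAt
      (fun x : ℂ × ℝ => (x.1, (f x.1 : ℂ) * Complex.exp (Complex.I * x.2))) _ (z, θ) :=
    (hasFDerivAt_fst (𝕜 := ℝ) (p := (z, θ))).prodMk (h1.mul h2)
  have hexp : Complex.exp (Complex.I * θ) = Real.cos θ + Real.sin θ * Complex.I := by
    rw [mul_comm, Complex.exp_mul_I, Complex.ofReal_cos, Complex.ofReal_sin]
  have hsc := Real.sin_sq_add_cos_sq θ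
  rw [gramJacobian]
  simp only [h3.fderiv]
  rw [← Real.sqrt_sq_eq_abs, ← Real.sqrt_mul (sq_nonneg _), Matrix.det_fin_three]
  congr 1
  simp [euclideanInner, hexp, Complex.inner, -Complex.ofReal_cos, -Complex.ofReal_sin]
  linear_combination (f z ^ 2 + f z ^ 2 * (f' 1 ^ 2 + f' Complex.I ^ 2) *
    (Real.sin θ ^ 2 + Real.cos θ ^ 2 + 1)) * hsc

/-- The profile as a function of `|z|²`. -/
def radialProfile (A B α s : ℝ) : ℝ := (1 - s) ^ A * Real.exp (-B / (1 - s) ^ α)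

/-- The derivative of `radialProfile`. -/
def radialProfileDeriv (A B α s : ℝ) : ℝ :=
  -(radialProfile A B α s * (A * (1 - s)⁻¹ + B * α * ((1 - s) ^ (α + 1))⁻¹))

theorem hasDerivAt_radialProfile (A B α : ℝ) {s : ℝ} (hs : s < 1) :
    HasDerivAt (radialProfile A B α) (radialProfileDeriv A B α s) s := by
  have h : 0 < 1 - s := by linarith
  have h0 : HasDerivAt (fun s : ℝ => 1 - s) (-1) s := (hasDerivAt_id s).const_sub 1
  have h1 := h0.rpow_const (p := A) (Or.inl h.ne')
  have h2 := h0.rpow_const (p := α) (Or.inl h.ne')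
  have h3 := ((h2.inv (Real.rpow_pos_of_pos h _).ne').const_mul (-B)).exp
  refine (h1.mul h3).congr_deriv ?_
  have hα := (Real.rpow_pos_of_pos h α).ne'
  rw [radialProfileDeriv, radialProfile, Real.rpow_sub h, Real.rpow_sub h, Real.rpow_add h,
    Real.rpow_one]
  simp only [Pi.inv_apply]
  rw [← div_eq_mul_inv (-B)]
  field_simp
  ring

theorem hasFDerivAt_profile (A B α : ℝ) {z : ℂ} (hz : ‖z‖ < 1) :
    HasFDerivAt (profile A B α)
      (radialProfileDeriv A B α (‖z‖ ^ 2) • (2 • innerSL ℝ z)) z := by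
  have h1 : HasFDerivAt (fun z : ℂ => ‖z‖ ^ 2) (2 • innerSL ℝ z) z :=
    (hasStrictFDerivAt_norm_sq z).hasFDerivAt
  exact (hasDerivAt_radialProfile A B α (by linarith [one_sub_norm_sq_pos hz])).comp_hasFDerivAt z h1

/-- The density of the surface measure with respect to the parameters `(z, θ)`, as a function
of `|z|`. -/
def radialDensity (A B α r : ℝ) : ℝ :=
  radialProfile A B α (r ^ 2) *
    Real.sqrt (1 + (2 * r * radialProfileDeriv A B α (r ^ 2)) ^ 2)

theorem gramJacobian_boundaryParam (A B α : ℝ) {z : ℂ} (hz : ‖z‖ < 1) (θ : ℝ) :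
    gramJacobian (boundaryParam A B α) (z, θ) = radialDensity A B α ‖z‖ := by
  rw [show boundaryParam A B α = fun x : ℂ × ℝ =>
    (x.1, (profile A B α x.1 : ℂ) * Complex.exp (Complex.I * x.2)) from rfl,
    gramJacobian_rotation_graph (hasFDerivAt_profile A B α hz),
    abs_of_pos (profile_pos A B α hz), radialDensity, add_assoc]
  have : ‖z‖ ^ 2 = z.re ^ 2 + z.im ^ 2 := by
    rw [← Complex.normSq_eq_norm_sq, Complex.normSq_apply]; ring
  congr 3
  simp [Complex.inner]
  linear_combination (-4 * radialProfileDeriv A B α (‖z‖ ^ 2) ^ 2) * this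

/-- With `y = B / x^α` one has `e^{-y} ≤ m!/yᵐ`, and any integer `m ≥ k/α` beats the power. -/
theorem rpow_neg_mul_exp_le {B α : ℝ} (hB : 0 < B) (hα : 0 < α) (k : ℝ) : ∃ K : ℝ, ∀ x : ℝ,
    0 < x → x ≤ 1 → x ^ (-k) * Real.exp (-B / x ^ α) ≤ K := by
  obtain ⟨m, hm⟩ := exists_nat_ge (k / α)
  rw [div_le_iff₀ hα] at hm
  refine ⟨m.factorial / B ^ m, fun x hx hx1 => ?_⟩
  have hxα : 0 < x ^ α := Real.rpow_pos_of_pos hx _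
  have h1 := Real.pow_div_factorial_le_exp (B / x ^ α) (div_pos hB hxα).le m
  have h2 : x ^ (-k) ≤ ((x ^ α) ^ m)⁻¹ := by
    rw [← Real.rpow_natCast (x ^ α), ← Real.rpow_mul hx.le, ← Real.rpow_neg hx.le]
    exact Real.rpow_le_rpow_of_exponent_ge hx hx1 (by linarith)
  rw [neg_div, Real.exp_neg]
  have h3 : 0 < (B / x ^ α) ^ m / m.factorial := by positivity
  calc _ ≤ ((x ^ α) ^ m)⁻¹ * ((B / x ^ α) ^ m / m.factorial)⁻¹ := by gcongr
    _ = m.factorial / B ^ m := by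
      rw [div_pow]; field_simp

theorem radialProfile_pos (A B α : ℝ) {s : ℝ} (hs : s < 1) : 0 < radialProfile A B α s :=
  mul_pos (Real.rpow_pos_of_pos (by linarith) _) (Real.exp_pos _)

theorem le_radialDensity (A B α : ℝ) {r : ℝ} (hr : 0 ≤ r) (hr1 : r < 1) :
    radialProfile A B α (r ^ 2) ≤ radialDensity A B α r := by
  refine le_mul_of_one_le_right (radialProfile_pos A B α (by nlinarith)).le ?_
  exact Real.one_le_sqrt.2 (by nlinarith [sq_nonneg (2 * r * radialProfileDeriv A B α (r ^ 2))])

theorem radialDensity_pos (A B α : ℝ) {r : ℝ} (hr : 0 ≤ r) (hr1 : r < 1) :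
    0 < radialDensity A B α r :=
  (radialProfile_pos A B α (by nlinarith)).trans_le (le_radialDensity A B α hr hr1)

/-- The exponential absorbs the negative powers in the derivative of the profile, so the square root
in the density is bounded. The exponential factor of the profile is left intact, since its exact
rate fixes the moment asymptotics. -/
theorem exists_radialDensity_le {A B α : ℝ} (hA : 0 ≤ A) (hB : 0 < B) (hα : 0 < α) :
    ∃ K : ℝ, 0 < K ∧ ∀ r : ℝ, 0 ≤ r → r < 1 →
      radialDensity A B α r ≤ K * Real.exp (-B / (1 - r ^ 2) ^ α) := by
  obtain ⟨K₁, hK₁⟩ := rpow_neg_mul_exp_le hB hα 1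
  obtain ⟨K₂, hK₂⟩ := rpow_neg_mul_exp_le hB hα (α + 1)
  refine ⟨1 + 2 * (A * K₁ + B * α * K₂), ?_, fun r hr hr1 => ?_⟩
  · have h1 := (mul_pos (Real.rpow_pos_of_pos one_pos _) (Real.exp_pos _)).trans_le
      (hK₁ 1 one_pos le_rfl)
    have h2 := (mul_pos (Real.rpow_pos_of_pos one_pos _) (Real.exp_pos _)).trans_le
      (hK₂ 1 one_pos le_rfl)
    positivity
  have hx : 0 < 1 - r ^ 2 := by nlinarith
  have hx1 : 1 - r ^ 2 ≤ 1 := by nlinarith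
  have h1 : (1 - r ^ 2) ^ A ≤ 1 := Real.rpow_le_one hx.le hx1 hA
  have hp := radialProfile_pos A B α (s := r ^ 2) (by linarith)
  have hle : radialProfile A B α (r ^ 2) ≤ Real.exp (-B / (1 - r ^ 2) ^ α) :=
    mul_le_of_le_one_left (Real.exp_pos _).le h1
  have hk1 := hK₁ _ hx hx1
  have hk2 := hK₂ _ hx hx1
  rw [Real.rpow_neg hx.le, Real.rpow_one] at hk1
  rw [Real.rpow_neg hx.le] at hk2
  have hd : |radialProfileDeriv A B α (r ^ 2)| ≤ A * K₁ + B * α * K₂ := by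
    have hx' := inv_pos.2 (Real.rpow_pos_of_pos hx (α + 1))
    rw [radialProfileDeriv, abs_neg, abs_of_nonneg (by positivity)]
    calc _ ≤ Real.exp (-B / (1 - r ^ 2) ^ α) *
        (A * (1 - r ^ 2)⁻¹ + B * α * ((1 - r ^ 2) ^ (α + 1))⁻¹) := by gcongr
      _ = A * ((1 - r ^ 2)⁻¹ * Real.exp (-B / (1 - r ^ 2) ^ α)) +
        B * α * (((1 - r ^ 2) ^ (α + 1))⁻¹ * Real.exp (-B / (1 - r ^ 2) ^ α)) := by ring
      _ ≤ _ := by gcongr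
  have hd2 : |2 * r * radialProfileDeriv A B α (r ^ 2)| ≤ 2 * (A * K₁ + B * α * K₂) := by
    rw [abs_mul, abs_of_nonneg (by positivity : (0 : ℝ) ≤ 2 * r)]
    calc _ ≤ 2 * 1 * |radialProfileDeriv A B α (r ^ 2)| := by gcongr
      _ ≤ _ := by linarith
  have hs : Real.sqrt (1 + (2 * r * radialProfileDeriv A B α (r ^ 2)) ^ 2) ≤
      1 + 2 * (A * K₁ + B * α * K₂) := by
    rw [Real.sqrt_le_iff]
    have h0 := abs_nonneg (2 * r * radialProfileDeriv A B α (r ^ 2))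
    refine ⟨by linarith, ?_⟩
    rw [← sq_abs]
    nlinarith
  rw [radialDensity, mul_comm]
  have := Real.sqrt_nonneg (1 + (2 * r * radialProfileDeriv A B α (r ^ 2)) ^ 2)
  have := this.trans hs
  gcongr

/-! ### Integration against the surface measure -/

theorem measurable_radialDensity (A B α : ℝ) : Measurable (radialDensity A B α) := by
  unfold radialDensity radialProfileDeriv radialProfile
  fun_prop

theorem measurable_profile (A B α : ℝ) : Measurable (profile A B α) := by
  unfold profile
  fun_prop

theorem measurable_boundaryParam (A B α : ℝ) : Measurable (boundaryParam A B α) := by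
  have := measurable_profile A B α
  unfold boundaryParam
  fun_prop

theorem radialDensity_norm_pos {A B α : ℝ} {z : ℂ} (hz : z ∈ ball (0 : ℂ) 1) :
    0 < radialDensity A B α ‖z‖ :=
  radialDensity_pos A B α (norm_nonneg z) (by simpa using hz)

/-- The parameter set `𝔻 × (0, 2π)`. -/
def paramSet : Set (ℂ × ℝ) := ball (0 : ℂ) 1 ×ˢ Set.Ioo 0 (2 * Real.pi)

theorem measurableSet_paramSet : MeasurableSet paramSet := measurableSet_ball.prod measurableSet_Ioo

theorem measurable_density (A B α : ℝ) :
    Measurable fun x : ℂ × ℝ => ENNReal.ofReal (radialDensity A B α ‖x.1‖) :=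
  ENNReal.measurable_ofReal.comp ((measurable_radialDensity A B α).comp (by fun_prop))

theorem surfaceMeasure_eq (A B α : ℝ) : surfaceMeasure A B α =
    ((volume.restrict paramSet).withDensity fun x =>
      ENNReal.ofReal (radialDensity A B α ‖x.1‖)).map (boundaryParam A B α) := by
  rw [surfaceMeasure, parametrizedSurfaceMeasure]
  congr 1
  refine withDensity_congr_ae ?_
  filter_upwards [ae_restrict_mem measurableSet_paramSet] with x hx
  rw [show x = (x.1, x.2) from rfl, gramJacobian_boundaryParam A B α (by simpa using hx.1)]

theorem ae_surfaceMeasure_of_forall {A B α : ℝ} {P : ℂ × ℂ → Prop} (hP : MeasurableSet {w | P w})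
    (h : ∀ x ∈ paramSet, P (boundaryParam A B α x)) : ∀ᵐ w ∂surfaceMeasure A B α, P w := by
  rw [surfaceMeasure_eq, ae_map_iff (measurable_boundaryParam A B α).aemeasurable hP]
  exact (withDensity_absolutelyContinuous _ _).ae_le ((ae_restrict_mem measurableSet_paramSet).mono h)

theorem norm_boundaryParam_snd {A B α : ℝ} {x : ℂ × ℝ} (hx : ‖x.1‖ < 1) :
    ‖(boundaryParam A B α x).2‖ = profile A B α x.1 := by
  rw [boundaryParam, norm_mul, mul_comm Complex.I, Complex.norm_exp_ofReal_mul_I, mul_one,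
    Complex.norm_real, Real.norm_of_nonneg (profile_pos A B α hx).le]

theorem mk_mem_closure_reinhardtDomain {A B α : ℝ} {z w : ℂ} (hz : ‖z‖ < 1)
    (hw : ‖w‖ ≤ profile A B α z) : (z, w) ∈ closure (reinhardtDomain A B α) := by
  have h : Set.MapsTo (fun w : ℂ => (z, w)) (ball 0 (profile A B α z)) (reinhardtDomain A B α) :=
    fun w hw => ⟨hz, by simpa using hw⟩
  refine h.closure (by fun_prop) ?_
  rw [closure_ball _ (profile_pos A B α hz).ne']
  simpa using hw

theorem boundaryParam_mem_closure {A B α : ℝ} {x : ℂ × ℝ} (hx : x ∈ paramSet) :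
    boundaryParam A B α x ∈ closure (reinhardtDomain A B α) := by
  have h : ‖x.1‖ < 1 := by simpa using hx.1
  exact mk_mem_closure_reinhardtDomain h (norm_boundaryParam_snd h).le

theorem ae_surfaceMeasure_mem_closure (A B α : ℝ) :
    ∀ᵐ w ∂surfaceMeasure A B α, w ∈ closure (reinhardtDomain A B α) :=
  ae_surfaceMeasure_of_forall isClosed_closure.measurableSet fun _ hx => boundaryParam_mem_closure hx

theorem ae_surfaceMeasure_norm_fst_lt (A B α : ℝ) : ∀ᵐ w ∂surfaceMeasure A B α, ‖w.1‖ < 1 :=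
  ae_surfaceMeasure_of_forall (measurableSet_lt (by fun_prop) measurable_const)
    fun x hx => by simpa [boundaryParam] using hx.1

theorem lintegral_surfaceMeasure_fst {A B α : ℝ} {g : ℂ → ℝ≥0∞} (hg : Measurable g) :
    ∫⁻ w, g w.1 ∂surfaceMeasure A B α = ENNReal.ofReal (2 * Real.pi) *
      ∫⁻ z in ball (0 : ℂ) 1, ENNReal.ofReal (radialDensity A B α ‖z‖) * g z := by
  have hm := measurable_density A B α
  have hm' : Measurable fun z : ℂ => ENNReal.ofReal (radialDensity A B α ‖z‖) :=
    ENNReal.measurable_ofReal.comp ((measurable_radialDensity A B α).comp measurable_norm)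
  have hg' : Measurable fun x : ℂ × ℝ => g (boundaryParam A B α x).1 := hg.comp measurable_fst
  rw [surfaceMeasure_eq, lintegral_map (by fun_prop) (measurable_boundaryParam A B α),
    lintegral_withDensity_eq_lintegral_mul _ hm hg', paramSet, Measure.volume_eq_prod,
    ← Measure.prod_restrict, lintegral_prod _ (hm.mul hg').aemeasurable]
  simp only [Pi.mul_apply, boundaryParam, lintegral_const,
    Measure.restrict_apply MeasurableSet.univ, Set.univ_inter, Real.volume_Ioo, sub_zero]
  rw [lintegral_mul_const _ (by fun_prop), mul_comm]

theorem exists_radialDensity_le_const {A B α : ℝ} (hA : 0 ≤ A) (hB : 0 < B) (hα : 0 < α) :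
    ∃ K : ℝ, 0 < K ∧ ∀ r : ℝ, 0 ≤ r → r < 1 → radialDensity A B α r ≤ K := by
  obtain ⟨K, hK, hle⟩ := exists_radialDensity_le hA hB hα
  refine ⟨K, hK, fun r hr hr1 => (hle r hr hr1).trans (mul_le_of_le_one_right hK.le ?_)⟩
  rw [Real.exp_le_one_iff, neg_div, Left.neg_nonpos_iff]
  have : 0 < 1 - r ^ 2 := by nlinarith
  positivity

theorem isFiniteMeasure_surfaceMeasure {A B α : ℝ} (hA : 0 ≤ A) (hB : 0 < B) (hα : 0 < α) :
    IsFiniteMeasure (surfaceMeasure A B α) := by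
  obtain ⟨K, hK, hle⟩ := exists_radialDensity_le_const hA hB hα
  refine ⟨?_⟩
  rw [← lintegral_one, lintegral_surfaceMeasure_fst (g := fun _ => 1) measurable_const]
  refine ENNReal.mul_lt_top ENNReal.ofReal_lt_top ?_
  calc _ ≤ ∫⁻ z in ball (0 : ℂ) 1, ENNReal.ofReal K := by
        refine setLIntegral_mono measurable_const fun z hz => ?_
        rw [mul_one]
        exact ENNReal.ofReal_le_ofReal (hle _ (norm_nonneg z) (by simpa using hz))
    _ < ⊤ := by
        rw [setLIntegral_const]
        exact ENNReal.mul_lt_top ENNReal.ofReal_lt_top measure_ball_lt_top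

theorem integral_surfaceMeasure {A B α : ℝ} {F : ℂ × ℂ → ℂ} (hF : Integrable F (surfaceMeasure A B α)) :
    ∫ w, F w ∂surfaceMeasure A B α = ∫ z in ball (0 : ℂ) 1, (radialDensity A B α ‖z‖ : ℂ) *
      ∫ θ in Set.Ioo 0 (2 * Real.pi), F (boundaryParam A B α (z, θ)) := by
  have hΨ := (measurable_boundaryParam A B α).aemeasurable
    (μ := (volume.restrict paramSet).withDensity fun x =>
      ENNReal.ofReal (radialDensity A B α ‖x.1‖))
  have hm := measurable_density A B α
  rw [surfaceMeasure_eq] at hF ⊢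
  have hF' := hF.aestronglyMeasurable
  have hlt : ∀ᵐ x : ℂ × ℝ ∂volume.restrict paramSet,
      ENNReal.ofReal (radialDensity A B α ‖x.1‖) < ⊤ :=
    Filter.Eventually.of_forall fun _ => ENNReal.ofReal_lt_top
  rw [integrable_map_measure hF' hΨ, integrable_withDensity_iff_integrable_smul' hm hlt] at hF
  rw [integral_map hΨ hF', integral_withDensity_eq_integral_toReal_smul hm hlt]
  rw [paramSet, Measure.volume_eq_prod] at hF ⊢
  refine (setIntegral_prod _ hF).trans ?_
  refine setIntegral_congr_fun measurableSet_ball fun z hz => ?_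
  simp only [ENNReal.toReal_ofReal (radialDensity_norm_pos (A := A) (B := B) (α := α) hz).le,
    Complex.real_smul]
  exact integral_const_mul _ _

theorem integral_surfaceMeasure_fst {A B α : ℝ} {g : ℂ → ℂ}
    (hg : Integrable (fun w : ℂ × ℂ => g w.1) (surfaceMeasure A B α)) :
    ∫ w, g w.1 ∂surfaceMeasure A B α =
      2 * Real.pi * ∫ z in ball (0 : ℂ) 1, (radialDensity A B α ‖z‖ : ℂ) * g z := by
  rw [integral_surfaceMeasure hg, ← integral_const_mul]
  refine integral_congr_ae (Filter.Eventually.of_forall fun z => ?_)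
  simp only [boundaryParam, integral_const, Complex.real_smul]
  simp [Measure.real, Real.pi_pos.le]
  ring

/-- This is the mean value property of `F (z, ·)` on the disc of radius `φ(z)`. Averaging in `θ`
removes all dependence on `z₂`. -/
theorem integral_circle_boundaryParam {A B α : ℝ} {F : ℂ × ℂ → ℂ}
    (hd : DifferentiableOn ℂ F (reinhardtDomain A B α))
    (hc : ContinuousOn F (closure (reinhardtDomain A B α))) {z : ℂ} (hz : ‖z‖ < 1) :
    ∫ θ in Set.Ioo 0 (2 * Real.pi), F (boundaryParam A B α (z, θ)) = 2 * Real.pi * F (z, 0) := by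
  have hp := profile_pos A B α hz
  have h : DiffContOnCl ℂ (fun w => F (z, w)) (ball 0 |profile A B α z|) := by
    rw [abs_of_pos hp]
    refine ⟨hd.comp (f := fun w : ℂ => (z, w)) (by fun_prop) fun w hw => ⟨hz, by simpa using hw⟩,
      hc.comp (f := fun w : ℂ => (z, w)) (by fun_prop) fun w hw => ?_⟩
    rw [closure_ball _ hp.ne'] at hw
    exact mk_mem_closure_reinhardtDomain hz (by simpa using hw)
  have := h.circleAverage
  rw [← this, Real.circleAverage, intervalIntegral.integral_of_le Real.two_pi_pos.le,
    ← integral_Ioc_eq_integral_Ioo, Complex.real_smul]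
  push_cast
  rw [mul_inv_cancel_left₀ (by simp [Real.pi_ne_zero])]
  simp [boundaryParam, circleMap, mul_comm Complex.I]

theorem circleMap_eq_polarCoord_symm (r θ : ℝ) :
    circleMap 0 r θ = Complex.polarCoord.symm (r, θ) := by
  rw [Complex.polarCoord_symm_apply, circleMap_zero, Complex.exp_mul_I]
  push_cast
  rfl

theorem integral_Ioo_circleMap (G : ℂ → ℂ) (r : ℝ) :
    ∫ θ in Set.Ioo (-Real.pi) Real.pi, G (circleMap 0 r θ) =
      2 * Real.pi * Real.circleAverage G 0 r := by
  have h : Function.Periodic (fun θ => G (circleMap 0 r θ)) (2 * Real.pi) :=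
    fun θ => by simp only [periodic_circleMap 0 r θ]
  rw [Real.circleAverage, Complex.real_smul]
  push_cast
  rw [mul_inv_cancel_left₀ (by simp [Real.pi_ne_zero]), ← integral_Ioc_eq_integral_Ioo,
    ← intervalIntegral.integral_of_le (by linarith [Real.pi_pos])]
  have := h.intervalIntegral_add_eq (-Real.pi) 0
  rw [zero_add] at this
  rw [← this]
  congr 1
  ring

/-- `G` need not extend to the closed disc or be bounded; the bound on the product supplies the
integrability needed for Fubini. -/
theorem integral_ball_radial_mul {ρ : ℝ → ℝ} (hρ : Measurable ρ) {G : ℂ → ℂ}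
    (hG : ContinuousOn G (ball 0 1)) {C : ℝ} (hC : ∀ z ∈ ball (0 : ℂ) 1, ‖(ρ ‖z‖ : ℂ) * G z‖ ≤ C) :
    ∫ z in ball (0 : ℂ) 1, (ρ ‖z‖ : ℂ) * G z =
      ∫ r in Set.Ioo (0 : ℝ) 1, (r * ρ r : ℂ) * (2 * Real.pi * Real.circleAverage G 0 r) := by
  rw [← integral_indicator measurableSet_ball, ← Complex.integral_comp_polarCoord_symm,
    polarCoord_target]
  have hs : ∀ p ∈ Set.Ioo (0 : ℝ) 1 ×ˢ Set.Ioo (-Real.pi) Real.pi,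
      circleMap 0 p.1 p.2 ∈ ball (0 : ℂ) 1 := fun p hp => by
    simpa [abs_of_pos hp.1.1] using hp.1.2
  have h1 : ∀ p ∈ Set.Ioi (0 : ℝ) ×ˢ Set.Ioo (-Real.pi) Real.pi,
      p.1 • (ball (0 : ℂ) 1).indicator (fun z => (ρ ‖z‖ : ℂ) * G z) (Complex.polarCoord.symm p) =
      (Set.Ioo (0 : ℝ) 1 ×ˢ Set.Ioo (-Real.pi) Real.pi).indicator
        (fun p => (p.1 * ρ p.1 : ℂ) * G (circleMap 0 p.1 p.2)) p := by
    rintro ⟨r, θ⟩ ⟨hr, hθ⟩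
    have hr : 0 < r := hr
    rw [← circleMap_eq_polarCoord_symm]
    by_cases hr1 : r < 1
    · rw [Set.indicator_of_mem (hs (r, θ) ⟨⟨hr, hr1⟩, hθ⟩),
        Set.indicator_of_mem (Set.mk_mem_prod (show r ∈ Set.Ioo (0 : ℝ) 1 from ⟨hr, hr1⟩) hθ), Complex.real_smul,
        norm_circleMap_zero, abs_of_pos hr, mul_assoc]
    · rw [Set.indicator_of_notMem, Set.indicator_of_notMem, smul_zero]
      · exact fun h => hr1 h.1.2
      · simpa [abs_of_pos hr] using hr1
  rw [setIntegral_congr_fun (measurableSet_Ioi.prod measurableSet_Ioo) h1,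
    setIntegral_indicator (measurableSet_Ioo.prod measurableSet_Ioo),
    Set.inter_eq_self_of_subset_right (Set.prod_mono Set.Ioo_subset_Ioi_self subset_rfl),
    Measure.volume_eq_prod, setIntegral_prod]
  · refine setIntegral_congr_fun measurableSet_Ioo fun r _ => ?_
    simp only [integral_const_mul, integral_Ioo_circleMap]
  · have hm : AEStronglyMeasurable (fun p : ℝ × ℝ => (p.1 * ρ p.1 : ℂ) * G (circleMap 0 p.1 p.2))
        (volume.restrict (Set.Ioo (0 : ℝ) 1 ×ˢ Set.Ioo (-Real.pi) Real.pi)) := by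
      refine AEStronglyMeasurable.mul (Measurable.aestronglyMeasurable (by fun_prop)) ?_
      refine ContinuousOn.aestronglyMeasurable (hG.comp ?_ hs)
        (measurableSet_Ioo.prod measurableSet_Ioo)
      simp only [circleMap]
      fun_prop
    rw [← Measure.volume_eq_prod]
    refine IntegrableOn.of_bound ?_ hm C ?_
    · rw [Measure.volume_eq_prod, Measure.prod_prod]
      exact ENNReal.mul_lt_top measure_Ioo_lt_top measure_Ioo_lt_top
    · filter_upwards [ae_restrict_mem (measurableSet_Ioo.prod measurableSet_Ioo)] with p hp
      have := hC _ (hs p hp)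
      rw [norm_circleMap_zero, abs_of_pos hp.1.1] at this
      rw [mul_assoc, norm_mul, Complex.norm_real, Real.norm_of_nonneg hp.1.1.le]
      exact (mul_le_of_le_one_left (norm_nonneg _) hp.1.2.le).trans this

/-- On `|z| = r` one has `z̄ = r²/z`, so the average is `r²ⁿ` times the `n`-th Taylor coefficient of
`G` at the origin. -/
theorem exists_circleAverage_conj_pow_mul {G : ℂ → ℂ} (hG : DifferentiableOn ℂ G (ball 0 1))
    (n : ℕ) : ∃ a : ℂ, ∀ r ∈ Set.Ioo (0 : ℝ) 1,
      Real.circleAverage (fun z => (starRingEnd ℂ) z ^ n * G z) 0 r = (r : ℂ) ^ (2 * n) * a := by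
  have key : ∀ r ∈ Set.Ioo (0 : ℝ) 1,
      Real.circleAverage (fun z => (starRingEnd ℂ) z ^ n * G z) 0 r =
        (r : ℂ) ^ (2 * n) * (cauchyPowerSeries G 0 r n fun _ => 1) := fun r hr => by
    rw [cauchyPowerSeries_apply]
    have h1 : Real.circleAverage (fun z => (starRingEnd ℂ) z ^ n * G z) 0 r =
        Real.circleAverage (fun z => ((r : ℂ) ^ (2 * n)) • ((1 / (z - 0)) ^ n • G z)) 0 r := by
      refine Real.circleAverage_congr_sphere fun z hz => ?_
      rw [abs_of_pos hr.1, mem_sphere_zero_iff_norm] at hz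
      have hz0 : z ≠ 0 := by rw [← norm_pos_iff, hz]; exact hr.1
      have : (r : ℂ) ^ 2 = z * (starRingEnd ℂ) z := by
        rw [Complex.mul_conj, Complex.normSq_eq_norm_sq, hz]; push_cast; rfl
      simp only [smul_eq_mul, pow_mul, this, mul_pow, sub_zero, one_div, inv_pow]
      field_simp
    rw [h1, Real.circleAverage_fun_smul, smul_eq_mul, Real.circleAverage_eq_circleIntegral hr.1.ne']
    congr 2
    refine circleIntegral.integral_congr hr.1.le fun z _ => ?_
    rw [smul_comm]
  have hps : ∀ r ∈ Set.Ioo (0 : ℝ) 1, HasFPowerSeriesAt G (cauchyPowerSeries G 0 r) 0 :=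
    fun r hr => by
    have := DifferentiableOn.hasFPowerSeriesOnBall (R := ⟨r, hr.1.le⟩) (c := 0) (f := G)
      (hG.mono (closedBall_subset_ball hr.2)) hr.1
    exact this.hasFPowerSeriesAt
  -- The radius `1/2` is arbitrary: uniqueness of the power series makes the coefficient independent
  -- of `r`.
  refine ⟨cauchyPowerSeries G 0 (1 / 2 : ℝ) n fun _ => 1, fun r hr => ?_⟩
  rw [key r hr, (hps r hr).eq_formalMultilinearSeries (hps (1 / 2) (by norm_num))]

theorem aestronglyMeasurable_of_continuousOn_closure {A B α : ℝ} {F : ℂ × ℂ → ℂ}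
    (hF : ContinuousOn F (closure (reinhardtDomain A B α))) :
    AEStronglyMeasurable F (surfaceMeasure A B α) := by
  have := hF.aestronglyMeasurable (μ := surfaceMeasure A B α) isClosed_closure.measurableSet
  rwa [Measure.restrict_eq_self_of_ae_mem (ae_surfaceMeasure_mem_closure A B α)] at this

/-! ### The projection of radial multiples of monomials -/

/-- Only `rⁿ κ(r)` is required to be bounded, so that `κ` may blow up at the origin, as `r⁻ⁿ` does.
-/
theorem memLp_pow_mul_radial {A B α : ℝ} (hA : 0 ≤ A) (hB : 0 < B) (hα : 0 < α) (n : ℕ)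
    {κ : ℝ → ℝ} (hκ : Measurable κ) {C : ℝ} (hC : ∀ r ∈ Set.Ico (0 : ℝ) 1, r ^ n * |κ r| ≤ C)
    (p : ℝ≥0∞) : MemLp (fun w : ℂ × ℂ => w.1 ^ n * (κ ‖w.1‖ : ℂ)) p (surfaceMeasure A B α) := by
  have := isFiniteMeasure_surfaceMeasure hA hB hα
  refine MemLp.of_bound (Measurable.aestronglyMeasurable (by fun_prop)) C ?_
  filter_upwards [ae_surfaceMeasure_norm_fst_lt A B α] with w hw
  rw [norm_mul, norm_pow, Complex.norm_real]
  exact hC _ ⟨norm_nonneg _, hw⟩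

/-- The `θ` average replaces `F` by `F (z, 0)`, and the average over the argument of `z` keeps only
its `n`-th Taylor coefficient `a`. Consequently the pairing vanishes for every `F` once the radial
moment of `κ` vanishes. -/
theorem exists_integral_mul_conj_pow_eq {A B α : ℝ} (hA : 0 ≤ A) (hB : 0 < B) (hα : 0 < α)
    {F : ℂ × ℂ → ℂ} (hd : DifferentiableOn ℂ F (reinhardtDomain A B α))
    (hc : ContinuousOn F (closure (reinhardtDomain A B α))) (n : ℕ)
    {κ : ℝ → ℝ} (hκ : Measurable κ) {C : ℝ} (hC : ∀ r ∈ Set.Ico (0 : ℝ) 1, r ^ n * |κ r| ≤ C) :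
    ∃ a : ℂ, ∫ w, F w * ((starRingEnd ℂ) w.1 ^ n * (κ ‖w.1‖ : ℂ)) ∂surfaceMeasure A B α =
      a * ∫ w, (‖w.1‖ ^ (2 * n) * κ ‖w.1‖ : ℝ) ∂surfaceMeasure A B α := by
  have hfin := isFiniteMeasure_surfaceMeasure hA hB hα
  obtain ⟨K, hK, hKle⟩ := exists_radialDensity_le_const hA hB hα
  have hcpt : IsCompact (closure (reinhardtDomain A B α)) :=
    (isBounded_reinhardtDomain hA hB hα).isCompact_closure
  obtain ⟨M, hM⟩ := hcpt.exists_bound_of_continuousOn hc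
  have hz0 : ∀ z ∈ ball (0 : ℂ) 1, (z, (0 : ℂ)) ∈ reinhardtDomain A B α := fun z hz =>
    have hz : ‖z‖ < 1 := by simpa using hz
    ⟨hz, by simpa using profile_pos A B α hz⟩
  have hM0 : 0 ≤ M := (norm_nonneg _).trans (hM 0 (subset_closure (zero_mem_reinhardtDomain A B α)))
  have hC0 : 0 ≤ C := (by positivity : (0 : ℝ) ≤ 0 ^ n * |κ 0|).trans (hC 0 (by simp))
  have hG : DifferentiableOn ℂ (fun z => F (z, 0)) (ball 0 1) :=
    hd.comp (f := fun z : ℂ => (z, (0 : ℂ))) (by fun_prop) hz0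
  have hbound : ∀ r ∈ Set.Ico (0 : ℝ) 1, |radialDensity A B α r * κ r| * r ^ n ≤ K * C := by
    intro r hr
    rw [abs_mul, abs_of_pos (radialDensity_pos A B α hr.1 hr.2), mul_assoc, mul_comm |κ r|]
    have := hC r hr
    have := hKle r hr.1 hr.2
    have := pow_nonneg hr.1 n
    gcongr
  have hρ : Measurable fun r => radialDensity A B α r * κ r :=
    (measurable_radialDensity A B α).mul hκ
  have hmem : ∀ z ∈ ball (0 : ℂ) 1, ‖z‖ ∈ Set.Ico (0 : ℝ) 1 := fun z hz =>
    ⟨norm_nonneg z, by simpa using hz⟩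
  obtain ⟨a, ha⟩ := exists_circleAverage_conj_pow_mul hG n
  have hint : Integrable (fun w : ℂ × ℂ => F w * ((starRingEnd ℂ) w.1 ^ n * (κ ‖w.1‖ : ℂ)))
      (surfaceMeasure A B α) := by
    refine Integrable.of_bound ((aestronglyMeasurable_of_continuousOn_closure hc).mul
      (Measurable.aestronglyMeasurable ?_)) (M * C) ?_
    · have : Measurable (starRingEnd ℂ) := Complex.continuous_conj.measurable
      fun_prop
    filter_upwards [ae_surfaceMeasure_norm_fst_lt A B α, ae_surfaceMeasure_mem_closure A B α]
      with w hw hw'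
    rw [norm_mul, norm_mul, norm_pow, RCLike.norm_conj, Complex.norm_real]
    exact mul_le_mul (hM w hw') (hC _ ⟨norm_nonneg _, hw⟩) (by positivity) hM0
  have hint2 : Integrable (fun w : ℂ × ℂ => ((‖w.1‖ ^ (2 * n) * κ ‖w.1‖ : ℝ) : ℂ))
      (surfaceMeasure A B α) := by
    refine Integrable.of_bound (Measurable.aestronglyMeasurable (by fun_prop)) C ?_
    filter_upwards [ae_surfaceMeasure_norm_fst_lt A B α] with w hw
    rw [Complex.norm_real, norm_mul, norm_pow, norm_norm, two_mul, pow_add, mul_assoc]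
    exact (mul_le_of_le_one_left (by positivity) (pow_le_one₀ (norm_nonneg _) hw.le)).trans
      (hC _ ⟨norm_nonneg _, hw⟩)
  refine ⟨a, ?_⟩
  have h1 : ∫ w, F w * ((starRingEnd ℂ) w.1 ^ n * (κ ‖w.1‖ : ℂ)) ∂surfaceMeasure A B α =
      2 * Real.pi * ∫ z in ball (0 : ℂ) 1, ((radialDensity A B α ‖z‖ * κ ‖z‖ : ℝ) : ℂ) *
        ((starRingEnd ℂ) z ^ n * F (z, 0)) := by
    rw [integral_surfaceMeasure hint, ← integral_const_mul]
    refine setIntegral_congr_fun measurableSet_ball fun z hz => ?_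
    simp only [show ∀ θ : ℝ, (boundaryParam A B α (z, θ)).1 = z from fun _ => rfl]
    rw [integral_mul_const, integral_circle_boundaryParam hd hc (by simpa using hz)]
    push_cast
    ring
  rw [h1, integral_ball_radial_mul hρ (G := fun z => (starRingEnd ℂ) z ^ n * F (z, 0))
    (C := K * C * M) ((Complex.continuous_conj.continuousOn.pow n).mul hG.continuousOn)]
  · rw [← integral_complex_ofReal]
    have h2 := integral_surfaceMeasure_fst (A := A) (B := B) (α := α)
      (g := fun z => ((‖z‖ ^ (2 * n) * κ ‖z‖ : ℝ) : ℂ)) hint2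
    rw [h2]
    have h3 := integral_ball_radial_mul (ρ := fun r => radialDensity A B α r * κ r)
      (G := fun z => ((‖z‖ ^ (2 * n) : ℝ) : ℂ)) hρ (by fun_prop) (C := K * C) ?_
    · have h4 : ∀ z : ℂ, (radialDensity A B α ‖z‖ : ℂ) * ((‖z‖ ^ (2 * n) * κ ‖z‖ : ℝ) : ℂ) =
          ((radialDensity A B α ‖z‖ * κ ‖z‖ : ℝ) : ℂ) * ((‖z‖ ^ (2 * n) : ℝ) : ℂ) := fun z => by
        push_cast; ring
      simp only [h4]
      rw [h3, mul_left_comm, ← integral_const_mul a]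
      congr 1
      refine setIntegral_congr_fun measurableSet_Ioo fun r hr => ?_
      have h5 : Real.circleAverage (fun z : ℂ => ((‖z‖ ^ (2 * n) : ℝ) : ℂ)) 0 r =
          (r : ℂ) ^ (2 * n) := by
        rw [Real.circleAverage_congr_sphere (f₂ := fun _ => (r : ℂ) ^ (2 * n)),
          Real.circleAverage_const]
        intro z hz
        rw [abs_of_pos hr.1, mem_sphere_zero_iff_norm] at hz
        simp [hz]
      simp only [ha r hr, h5]
      ring
    · intro z hz
      rw [norm_mul, Complex.norm_real, Complex.norm_real, norm_pow, norm_norm, two_mul, pow_add,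
        ← mul_assoc]
      exact (mul_le_of_le_one_right (by positivity)
        (pow_le_one₀ (norm_nonneg _) (hmem z hz).2.le)).trans (hbound _ (hmem z hz))
  · intro z hz
    rw [norm_mul, norm_mul, norm_pow, RCLike.norm_conj, Complex.norm_real, ← mul_assoc]
    exact mul_le_mul (hbound _ (hmem z hz)) (hM _ (subset_closure (hz0 z hz))) (norm_nonneg _)
      (by positivity)

/-- The Szegő projection of `z₁ⁿ k(|z₁|)` is a multiple of `z₁ⁿ`. -/
theorem szegoProjection_pow_mul_radial {A B α : ℝ} (hA : 0 ≤ A) (hB : 0 < B) (hα : 0 < α) (n : ℕ)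
    {k : ℝ → ℝ} (hk : Measurable k) {C : ℝ} (hC : ∀ r ∈ Set.Ico (0 : ℝ) 1, r ^ n * |k r| ≤ C)
    {c : ℝ} (hc : c * ∫ w, ‖w.1‖ ^ (2 * n) ∂surfaceMeasure A B α =
      ∫ w, ‖w.1‖ ^ (2 * n) * k ‖w.1‖ ∂surfaceMeasure A B α) :
    szegoProjection (reinhardtDomain A B α) (surfaceMeasure A B α)
      (memLp_pow_mul_radial hA hB hα n hk hC 2).toLp =ᵐ[surfaceMeasure A B α]
        fun w => w.1 ^ n * (c : ℂ) := by
  have hfin := isFiniteMeasure_surfaceMeasure hA hB hα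
  set u := (memLp_pow_mul_radial hA hB hα n hk hC 2).toLp with hu
  have hcb : ∀ r ∈ Set.Ico (0 : ℝ) 1, r ^ n * |(fun _ : ℝ => c) r| ≤ |c| := fun r hr =>
    mul_le_of_le_one_left (abs_nonneg _) (pow_le_one₀ hr.1 hr.2.le)
  set v := (memLp_pow_mul_radial hA hB hα n (measurable_const (a := c)) hcb 2).toLp with hv
  have hue := (memLp_pow_mul_radial hA hB hα n hk hC 2).coeFn_toLp
  have hve := (memLp_pow_mul_radial hA hB hα n (measurable_const (a := c)) hcb 2).coeFn_toLp
  suffices h : szegoProjection (reinhardtDomain A B α) (surfaceMeasure A B α) u = v by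
    rw [h]; exact hve
  refine Submodule.eq_starProjection_of_mem_orthogonal ?_ ?_
  · refine Submodule.le_topologicalClosure _ ⟨fun w => w.1 ^ n * (c : ℂ), ?_, ?_, hve⟩ <;> fun_prop
  · rw [hardySpace, Submodule.orthogonal_closure, Submodule.mem_orthogonal']
    rintro g ⟨F, hFd, hFc, hgF⟩
    have hκC : ∀ r ∈ Set.Ico (0 : ℝ) 1, r ^ n * |k r - c| ≤ C + |c| := fun r hr => by
      have h1 := hC r hr
      have h2 := hcb r hr
      have h3 := mul_le_mul_of_nonneg_left (abs_sub (k r) c) (pow_nonneg hr.1 n)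
      simp only at h2
      linarith
    -- Orthogonality of `u - v` to the Hardy space: it corresponds to `κ = k - c`, and `c` was
    -- chosen to make the radial moment of this `κ` zero.
    obtain ⟨a, ha⟩ := exists_integral_mul_conj_pow_eq hA hB hα hFd hFc n (κ := fun r => k r - c)
      (hk.sub (measurable_const (a := c))) hκC
    have hzero : ∫ w, (‖w.1‖ ^ (2 * n) * (k ‖w.1‖ - c) : ℝ) ∂surfaceMeasure A B α = 0 := by
      simp only [mul_sub]
      rw [integral_sub, integral_mul_const, mul_comm _ c, hc, sub_self]
      · refine Integrable.of_bound (Measurable.aestronglyMeasurable (by fun_prop)) C ?_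
        filter_upwards [ae_surfaceMeasure_norm_fst_lt A B α] with w hw
        rw [norm_mul, norm_pow, norm_norm, two_mul, pow_add, mul_assoc]
        exact (mul_le_of_le_one_left (by positivity) (pow_le_one₀ (norm_nonneg _) hw.le)).trans
          (hC _ ⟨norm_nonneg _, hw⟩)
      · refine Integrable.mul_const (Integrable.of_bound
          (Measurable.aestronglyMeasurable (by fun_prop)) 1 ?_) _
        filter_upwards [ae_surfaceMeasure_norm_fst_lt A B α] with w hw
        rw [norm_pow, norm_norm]
        exact pow_le_one₀ (norm_nonneg _) hw.le
    rw [hzero, Complex.ofReal_zero, mul_zero] at ha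
    rw [L2.inner_def, ← ha]
    refine integral_congr_ae ?_
    filter_upwards [hgF, hue, hve, Lp.coeFn_sub u v] with w h1 h2 h3 h4
    rw [h4, Pi.sub_apply, h1, h2, h3, RCLike.inner_apply]
    simp only [map_sub, map_mul, map_pow, Complex.conj_ofReal]
    push_cast
    ring

/-! ### Moments and Laplace asymptotics -/

/-- The moments `∫ |z₁|ᵗ dσ` of the surface measure. -/
def moment (A B α t : ℝ) : ℝ := ∫ w, ‖w.1‖ ^ t ∂surfaceMeasure A B α

theorem integrable_norm_fst_rpow {A B α : ℝ} (hA : 0 ≤ A) (hB : 0 < B) (hα : 0 < α) {t : ℝ}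
    (ht : 0 ≤ t) : Integrable (fun w : ℂ × ℂ => ‖w.1‖ ^ t) (surfaceMeasure A B α) := by
  have := isFiniteMeasure_surfaceMeasure hA hB hα
  refine Integrable.of_bound (Measurable.aestronglyMeasurable (by fun_prop)) 1 ?_
  filter_upwards [ae_surfaceMeasure_norm_fst_lt A B α] with w hw
  rw [Real.norm_of_nonneg (by positivity)]
  exact Real.rpow_le_one (norm_nonneg _) hw.le ht

theorem ofReal_moment {A B α : ℝ} (hA : 0 ≤ A) (hB : 0 < B) (hα : 0 < α) {t : ℝ} (ht : 0 ≤ t) :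
    ENNReal.ofReal (moment A B α t) = ENNReal.ofReal (2 * Real.pi) *
      ∫⁻ z in ball (0 : ℂ) 1, ENNReal.ofReal (radialDensity A B α ‖z‖) *
        ENNReal.ofReal (‖z‖ ^ t) := by
  rw [moment, ofReal_integral_eq_lintegral_ofReal (integrable_norm_fst_rpow hA hB hα ht)
    (Filter.Eventually.of_forall fun _ => by positivity)]
  exact lintegral_surfaceMeasure_fst (g := fun z => ENNReal.ofReal (‖z‖ ^ t)) (by fun_prop)

/-- In the variable `x = 1 - |z|²`, planar area is `π dx`. -/
theorem volume_annulus {x₁ x₂ : ℝ} (h12 : x₁ < x₂) (h2 : x₂ < 1) :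
    volume {z : ℂ | x₁ < 1 - ‖z‖ ^ 2 ∧ 1 - ‖z‖ ^ 2 ≤ x₂} =
      ENNReal.ofReal (Real.pi * (x₂ - x₁)) := by
  have hs : ∀ x : ℝ, x < 1 → 0 ≤ 1 - x := fun x hx => by linarith
  have h : {z : ℂ | x₁ < 1 - ‖z‖ ^ 2 ∧ 1 - ‖z‖ ^ 2 ≤ x₂} =
      ball 0 (Real.sqrt (1 - x₁)) \ ball 0 (Real.sqrt (1 - x₂)) := by
    ext z
    simp only [Set.mem_ofPred_eq, Set.mem_sdiff, mem_ball_zero_iff, Real.lt_sqrt (norm_nonneg z)]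
    constructor <;> rintro ⟨h1, h2⟩ <;> constructor <;> linarith
  have hpi : (NNReal.pi : ℝ≥0∞) = ENNReal.ofReal Real.pi := by
    rw [ENNReal.ofReal, Real.toNNReal_of_nonneg Real.pi_pos.le]; rfl
  rw [h, measure_sdiff (ball_subset_ball (Real.sqrt_le_sqrt (by linarith)))
    measurableSet_ball.nullMeasurableSet measure_ball_lt_top.ne, Complex.volume_ball,
    Complex.volume_ball, ← ENNReal.ofReal_pow (Real.sqrt_nonneg _),
    ← ENNReal.ofReal_pow (Real.sqrt_nonneg _), Real.sq_sqrt (hs _ (h12.trans h2)),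
    Real.sq_sqrt (hs _ h2), hpi, ← ENNReal.ofReal_mul (hs _ (h12.trans h2)),
    ← ENNReal.ofReal_mul (hs _ h2), ← ENNReal.ofReal_sub _ (mul_nonneg (hs _ h2) Real.pi_pos.le)]
  congr 1
  ring

/-- The density is at least the profile, which increases with `x = 1 - |z|²` and so is smallest at
the end `x₁`. -/
theorem le_surfaceMeasure_annulus {A B α : ℝ} (hA : 0 ≤ A) (hB : 0 < B) (hα : 0 < α) {x₁ x₂ : ℝ}
    (h1 : 0 < x₁) (h12 : x₁ < x₂) (h2 : x₂ < 1) :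
    ENNReal.ofReal (2 * Real.pi * (x₁ ^ A * Real.exp (-B / x₁ ^ α) * (Real.pi * (x₂ - x₁)))) ≤
      surfaceMeasure A B α {w | x₁ < 1 - ‖w.1‖ ^ 2 ∧ 1 - ‖w.1‖ ^ 2 ≤ x₂} := by
  set S : Set ℂ := {z : ℂ | x₁ < 1 - ‖z‖ ^ 2 ∧ 1 - ‖z‖ ^ 2 ≤ x₂} with hS
  have hSm : MeasurableSet S :=
    (measurableSet_lt (f := fun _ : ℂ => x₁) (g := fun z : ℂ => 1 - ‖z‖ ^ 2)
      (by fun_prop) (by fun_prop)).inter (measurableSet_le (f := fun z : ℂ => 1 - ‖z‖ ^ 2)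
        (g := fun _ : ℂ => x₂) (by fun_prop) (by fun_prop))
  have hSb : S ⊆ ball 0 1 := fun z hz => by
    rw [mem_ball_zero_iff]
    have := hz.1
    nlinarith [norm_nonneg z]
  have hg := lintegral_surfaceMeasure_fst (A := A) (B := B) (α := α) (g := S.indicator 1)
    (measurable_one.indicator hSm)
  have h3 : ∫⁻ w, S.indicator 1 w.1 ∂surfaceMeasure A B α =
      surfaceMeasure A B α {w | x₁ < 1 - ‖w.1‖ ^ 2 ∧ 1 - ‖w.1‖ ^ 2 ≤ x₂} := by
    exact lintegral_indicator_one (μ := surfaceMeasure A B α) (measurable_fst hSm)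
  rw [← h3, hg, ENNReal.ofReal_mul Real.two_pi_pos.le]
  gcongr
  have hpos : 0 ≤ x₁ ^ A * Real.exp (-B / x₁ ^ α) := by positivity
  calc _ = ∫⁻ z in S, ENNReal.ofReal (x₁ ^ A * Real.exp (-B / x₁ ^ α)) := by
        rw [setLIntegral_const, volume_annulus h12 h2, ENNReal.ofReal_mul hpos]
    _ ≤ ∫⁻ z in S, ENNReal.ofReal (radialDensity A B α ‖z‖) * S.indicator 1 z := by
        refine setLIntegral_mono' hSm fun z hz => ?_
        rw [Set.indicator_of_mem hz, Pi.one_apply, mul_one]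
        refine ENNReal.ofReal_le_ofReal (le_trans ?_ (le_radialDensity A B α (norm_nonneg z)
          (by simpa using hSb hz)))
        have hx := hz.1.le
        have h4 : x₁ ^ A ≤ (1 - ‖z‖ ^ 2) ^ A := Real.rpow_le_rpow h1.le hx hA
        have h5 : x₁ ^ α ≤ (1 - ‖z‖ ^ 2) ^ α := Real.rpow_le_rpow h1.le hx hα.le
        have h6 : 0 < x₁ ^ α := Real.rpow_pos_of_pos h1 _
        have h7 : -B / x₁ ^ α ≤ -B / (1 - ‖z‖ ^ 2) ^ α := by
          rw [neg_div, neg_div, neg_le_neg_iff]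
          gcongr
        have h8 : 0 ≤ (1 - ‖z‖ ^ 2) ^ A := Real.rpow_nonneg (h1.le.trans hx) _
        rw [radialProfile]
        gcongr
    _ ≤ _ := lintegral_mono_set hSb

/-- Markov's inequality: on the annulus `|z|ᵗ ≥ (1 - x₂)^{t/2}`. -/
theorem le_moment {A B α : ℝ} (hA : 0 ≤ A) (hB : 0 < B) (hα : 0 < α) {x₁ x₂ t : ℝ}
    (h1 : 0 < x₁) (h12 : x₁ < x₂) (h2 : x₂ < 1) (ht : 0 ≤ t) :
    (1 - x₂) ^ (t / 2) *
      (2 * Real.pi * (x₁ ^ A * Real.exp (-B / x₁ ^ α) * (Real.pi * (x₂ - x₁)))) ≤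
      moment A B α t := by
  have hfin := isFiniteMeasure_surfaceMeasure hA hB hα
  have hx2 : 0 < 1 - x₂ := by linarith
  have h3 := mul_meas_ge_le_integral_of_nonneg (μ := surfaceMeasure A B α)
    (f := fun w : ℂ × ℂ => ‖w.1‖ ^ t) (Filter.Eventually.of_forall fun _ => by positivity)
    (integrable_norm_fst_rpow hA hB hα ht) ((1 - x₂) ^ (t / 2))
  refine le_trans ?_ h3
  gcongr
  rw [Measure.real, ← ENNReal.ofReal_le_iff_le_toReal (measure_ne_top _ _)]
  refine (le_surfaceMeasure_annulus hA hB hα h1 h12 h2).trans (measure_mono fun w hw => ?_)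
  have : 1 - x₂ ≤ ‖w.1‖ ^ 2 := by linarith [hw.2]
  calc (1 - x₂) ^ (t / 2) ≤ (‖w.1‖ ^ 2) ^ (t / 2) := Real.rpow_le_rpow hx2.le this (by linarith)
    _ = ‖w.1‖ ^ t := by
      rw [← Real.rpow_natCast, ← Real.rpow_mul (norm_nonneg _)]
      congr 1
      push_cast
      ring

theorem moment_pos {A B α : ℝ} (hA : 0 ≤ A) (hB : 0 < B) (hα : 0 < α) {t : ℝ} (ht : 0 ≤ t) :
    0 < moment A B α t := by
  refine lt_of_lt_of_le ?_ (le_moment hA hB hα (x₁ := 1 / 4) (x₂ := 1 / 2)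
    (by norm_num) (by norm_num) (by norm_num) ht)
  have := Real.pi_pos
  have : (0 : ℝ) < 1 / 2 - 1 / 4 := by norm_num
  have : (0 : ℝ) < 1 - 1 / 2 := by norm_num
  positivity

/-- This infimum is the rate constant of Laplace's method, namely the minimal cost after rescaling
of the exponent `t x / 2 + B / x^α`. Near-minimisers suffice, so attainment is not needed. -/
theorem exists_isGLB_half_add_div_rpow {B α : ℝ} (hB : 0 < B) (hα : 0 < α) :
    ∃ c : ℝ, 0 < c ∧ (∀ y : ℝ, 0 < y → c ≤ y / 2 + B / y ^ α) ∧
      ∀ ε > 0, ∃ y : ℝ, 0 < y ∧ y / 2 + B / y ^ α < c + ε := by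
  set S : Set ℝ := (fun y : ℝ => y / 2 + B / y ^ α) '' Set.Ioi 0
  have hne : S.Nonempty := ⟨_, 1, Set.mem_Ioi.2 one_pos, rfl⟩
  have hlow : ∀ s ∈ S, min (1 / 2) B ≤ s := by
    rintro _ ⟨y, hy, rfl⟩
    have hy : 0 < y := hy
    have hyα : 0 < y ^ α := Real.rpow_pos_of_pos hy _
    have : 0 < B / y ^ α := div_pos hB hyα
    simp only
    rcases le_total 1 y with h | h
    · exact (min_le_left _ _).trans (by linarith)
    · have h1 : y ^ α ≤ 1 := Real.rpow_le_one hy.le h hα.le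
      have : B ≤ B / y ^ α := by rw [le_div_iff₀ hyα]; nlinarith
      exact (min_le_right _ _).trans (by linarith)
  have hbdd : BddBelow S := ⟨_, hlow⟩
  refine ⟨sInf S, (lt_min (by norm_num) hB).trans_le (le_csInf hne hlow),
    fun y hy => csInf_le hbdd ⟨y, hy, rfl⟩, fun ε hε => ?_⟩
  obtain ⟨_, ⟨y, hy, rfl⟩, h⟩ := exists_lt_of_csInf_lt hne (lt_add_of_pos_right (sInf S) hε)
  exact ⟨y, hy, h⟩

/-- The scale `x = y t^{-1/(1+α)}` balances `t x` against `x^{-α}`: both become multiples of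
`t^{α/(1+α)}`. -/
theorem rpow_scaling {α t : ℝ} (hα : 0 < α) (ht : 0 < t) :
    t * t ^ (-(1 / (1 + α))) = t ^ (α / (1 + α)) ∧
      (t ^ (-(1 / (1 + α)))) ^ α = (t ^ (α / (1 + α)))⁻¹ := by
  have h : 1 + α ≠ 0 := by positivity
  constructor
  · nth_rewrite 1 [← Real.rpow_one t]
    rw [← Real.rpow_add ht]
    congr 1
    field_simp
    ring
  · rw [← Real.rpow_mul ht.le, ← Real.rpow_neg ht.le]
    congr 1
    field_simp

/-- From `r² = 1 - x ≤ e^{-x}` the integrand is at most `K exp (-(t x / 2 + B / x^α))`. Rescaling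
bounds this pointwise by the infimum `c`, and the disc has finite area. -/
theorem moment_le {A B α : ℝ} (hA : 0 ≤ A) (hB : 0 < B) (hα : 0 < α) {c : ℝ}
    (hc : ∀ y : ℝ, 0 < y → c ≤ y / 2 + B / y ^ α) : ∃ K : ℝ, 0 < K ∧ ∀ t : ℝ, 0 < t →
      moment A B α t ≤ K * Real.exp (-(c * t ^ (α / (1 + α)))) := by
  obtain ⟨K, hK, hle⟩ := exists_radialDensity_le hA hB hα
  refine ⟨2 * Real.pi * (K * Real.pi), by positivity, fun t ht => ?_⟩
  have key : ∀ r : ℝ, 0 ≤ r → r < 1 → radialDensity A B α r * r ^ t ≤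
      K * Real.exp (-(c * t ^ (α / (1 + α)))) := fun r hr hr1 => by
    have hx : 0 < 1 - r ^ 2 := by nlinarith
    set x := 1 - r ^ 2 with hxdef
    obtain ⟨hs1, hs2⟩ := rpow_scaling hα ht
    set τ := t ^ (-(1 / (1 + α))) with hτ
    have hτ0 : 0 < τ := Real.rpow_pos_of_pos ht _
    have hβ : 0 < t ^ (α / (1 + α)) := Real.rpow_pos_of_pos ht _
    have h1 : r ^ t ≤ Real.exp (-(t * x / 2)) := by
      have h2 : r ≤ Real.exp (-(x / 2)) := by
        have h3 : r ^ 2 ≤ Real.exp (-(x / 2)) ^ 2 := by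
          rw [← Real.exp_nat_mul]
          have := Real.add_one_le_exp (-x)
          have h4 : ((2 : ℕ) : ℝ) * -(x / 2) = -x := by push_cast; ring
          rw [h4]
          linarith
        exact (sq_le_sq₀ hr (Real.exp_pos _).le).1 h3
      calc r ^ t ≤ Real.exp (-(x / 2)) ^ t := Real.rpow_le_rpow hr h2 ht.le
        _ = _ := by rw [← Real.exp_mul]; congr 1; ring
    have h2 := hc (x / τ) (div_pos hx hτ0)
    have h3 : c * t ^ (α / (1 + α)) ≤ t * x / 2 + B / x ^ α := by
      calc c * t ^ (α / (1 + α)) ≤ (x / τ / 2 + B / (x / τ) ^ α) * t ^ (α / (1 + α)) := by gcongr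
        _ = _ := by
          rw [Real.div_rpow hx.le hτ0.le, hs2, add_mul]
          nth_rewrite 1 [← hs1]
          have : x ^ α ≠ 0 := (Real.rpow_pos_of_pos hx _).ne'
          field_simp
    calc radialDensity A B α r * r ^ t ≤
        (K * Real.exp (-B / x ^ α)) * Real.exp (-(t * x / 2)) := by
          gcongr
          exact hle r hr hr1
      _ = K * Real.exp (-(t * x / 2 + B / x ^ α)) := by
          rw [mul_assoc, ← Real.exp_add]; congr 2; ring
      _ ≤ _ := by gcongr
  have hE : 0 ≤ K * Real.exp (-(c * t ^ (α / (1 + α)))) := by positivity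
  have hpi : (NNReal.pi : ℝ≥0∞) = ENNReal.ofReal Real.pi := by
    rw [ENNReal.ofReal, Real.toNNReal_of_nonneg Real.pi_pos.le]; rfl
  rw [← ENNReal.ofReal_le_ofReal_iff (by positivity), ofReal_moment hA hB hα ht.le]
  calc _ ≤ ENNReal.ofReal (2 * Real.pi) * ∫⁻ z in ball (0 : ℂ) 1,
        ENNReal.ofReal (K * Real.exp (-(c * t ^ (α / (1 + α))))) := by
        refine mul_le_mul_right ?_ _
        refine setLIntegral_mono measurable_const fun z hz => ?_
        rw [← ENNReal.ofReal_mul (radialDensity_norm_pos hz).le]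
        exact ENNReal.ofReal_le_ofReal (key _ (norm_nonneg z) (by simpa using hz))
    _ = _ := by
        rw [setLIntegral_const, Complex.volume_ball, hpi, ENNReal.ofReal_one, one_pow, one_mul,
          ← ENNReal.ofReal_mul hE, ← ENNReal.ofReal_mul (by positivity)]
        congr 1
        ring

/-- The limit of the right side of `neg_log_moment_le`: the annulus shrinks to the rim, and
constants and `log t` are negligible against `t^{α/(1+α)}`. -/
theorem tendsto_neg_log_moment_upper {A B α : ℝ} (hα : 0 < α) {y l : ℝ} :
    Filter.Tendsto (fun t : ℝ => (l * y / 2) / (1 - l * y * t ^ (-(1 / (1 + α)))) + B / y ^ α -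
      (Real.log (2 * Real.pi * Real.pi * (l - 1)) + (A + 1) *
        (Real.log y - 1 / (1 + α) * Real.log t)) / t ^ (α / (1 + α))) Filter.atTop
      (nhds (l * y / 2 + B / y ^ α)) := by
  have hβ : 0 < α / (1 + α) := by positivity
  have h1 : Filter.Tendsto (fun t : ℝ => t ^ (-(1 / (1 + α)))) Filter.atTop (nhds 0) :=
    tendsto_rpow_neg_atTop (by positivity)
  have h2 : Filter.Tendsto (fun t : ℝ => (t ^ (α / (1 + α)))⁻¹) Filter.atTop (nhds 0) :=
    (tendsto_rpow_atTop hβ).inv_tendsto_atTop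
  have h3 : Filter.Tendsto (fun t : ℝ => Real.log t / t ^ (α / (1 + α))) Filter.atTop (nhds 0) :=
    (isLittleO_log_rpow_atTop hβ).tendsto_div_nhds_zero
  have h4 : Filter.Tendsto (fun t : ℝ => (l * y / 2) / (1 - l * y * t ^ (-(1 / (1 + α)))))
      Filter.atTop (nhds (l * y / 2)) := by
    have h := (h1.const_mul (l * y)).const_sub 1
    simp only [mul_zero, sub_zero] at h
    have h' := (tendsto_const_nhds (x := l * y / 2)).div h one_ne_zero
    rw [div_one] at h'
    exact h'
  have h5 : Filter.Tendsto (fun t : ℝ => (Real.log (2 * Real.pi * Real.pi * (l - 1)) + (A + 1) *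
      (Real.log y - 1 / (1 + α) * Real.log t)) / t ^ (α / (1 + α))) Filter.atTop (nhds 0) := by
    have := (h2.const_mul (Real.log (2 * Real.pi * Real.pi * (l - 1)) + (A + 1) * Real.log y)).sub
      (h3.const_mul ((A + 1) * (1 / (1 + α))))
    simp only [mul_zero, sub_zero] at this
    refine this.congr fun t => ?_
    ring
  simpa using (h4.add_const (B / y ^ α)).sub h5

/-- The logarithm of `le_moment` on the annulus `yτ < x ≤ lyτ` with `τ = t^{-1/(1+α)}`. The factor
`(1 - x₂)^{t/2}` is controlled by `log u ≥ 1 - 1/u`. -/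
theorem neg_log_moment_le {A B α : ℝ} (hA : 0 ≤ A) (hB : 0 < B) (hα : 0 < α) {y l t : ℝ}
    (hy : 0 < y) (hl : 1 < l) (ht : 0 < t) (hlt : l * y * t ^ (-(1 / (1 + α))) < 1) :
    -Real.log (moment A B α t) / t ^ (α / (1 + α)) ≤
      (l * y / 2) / (1 - l * y * t ^ (-(1 / (1 + α)))) + B / y ^ α -
      (Real.log (2 * Real.pi * Real.pi * (l - 1)) + (A + 1) *
        (Real.log y - 1 / (1 + α) * Real.log t)) / t ^ (α / (1 + α)) := by
  obtain ⟨hs1, hs2⟩ := rpow_scaling hα ht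
  have hlogτ : Real.log (t ^ (-(1 / (1 + α)))) = -(1 / (1 + α)) * Real.log t := Real.log_rpow ht _
  set τ := t ^ (-(1 / (1 + α))) with hτ
  have hτ0 : 0 < τ := Real.rpow_pos_of_pos ht _
  have hβ : 0 < t ^ (α / (1 + α)) := Real.rpow_pos_of_pos ht _
  have hx1 : 0 < y * τ := mul_pos hy hτ0
  have hl1 : 0 < l - 1 := by linarith
  have hx2 : 0 < 1 - l * y * τ := by linarith
  have hpi := Real.pi_pos
  have h := le_moment hA hB hα (x₁ := y * τ) (x₂ := l * y * τ) hx1 (by nlinarith) hlt ht.le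
  have hxA : 0 < (y * τ) ^ A := Real.rpow_pos_of_pos hx1 _
  have heq : (1 - l * y * τ) ^ (t / 2) * (2 * Real.pi * ((y * τ) ^ A *
      Real.exp (-B / (y * τ) ^ α) * (Real.pi * (l * y * τ - y * τ)))) =
      (1 - l * y * τ) ^ (t / 2) * ((2 * Real.pi * Real.pi * (l - 1)) * ((y * τ) ^ A *
        ((y * τ) * Real.exp (-B / (y * τ) ^ α)))) := by ring
  rw [heq] at h
  have hD : 0 < 2 * Real.pi * Real.pi * (l - 1) := by positivity
  generalize 2 * Real.pi * Real.pi * (l - 1) = D at h hD ⊢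
  have hlog := Real.log_le_log (by positivity) h
  rw [Real.log_mul (by positivity) (by positivity), Real.log_mul (by positivity) (by positivity),
    Real.log_mul (by positivity) (by positivity), Real.log_mul (by positivity) (by positivity),
    Real.log_exp, Real.log_rpow hx2, Real.log_rpow hx1, Real.log_mul hy.ne' hτ0.ne', hlogτ,
    Real.mul_rpow hy.le hτ0.le, hs2] at hlog
  have h1 := Real.one_sub_inv_le_log_of_pos hx2
  have h2 : t / 2 * (1 - (1 - l * y * τ)⁻¹) ≤ t / 2 * Real.log (1 - l * y * τ) := by gcongr
  have h3 : t / 2 * (1 - (1 - l * y * τ)⁻¹) =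
      -((l * y / 2) / (1 - l * y * τ) * t ^ (α / (1 + α))) := by
    rw [← hs1]
    field_simp
    ring
  have h4 : -B / (y ^ α * (t ^ (α / (1 + α)))⁻¹) = -(B / y ^ α * t ^ (α / (1 + α))) := by
    have := (Real.rpow_pos_of_pos hy α).ne'
    field_simp
  rw [h4] at hlog
  rw [h3] at h2
  rw [div_le_iff₀ hβ, sub_mul, add_mul, div_mul_cancel₀ _ hβ.ne']
  linarith

/-- The logarithmic asymptotics of the moments. -/
theorem exists_tendsto_neg_log_moment {A B α : ℝ} (hA : 0 ≤ A) (hB : 0 < B) (hα : 0 < α) :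
    ∃ c : ℝ, 0 < c ∧ Filter.Tendsto (fun t => -Real.log (moment A B α t) / t ^ (α / (1 + α)))
      Filter.atTop (nhds c) := by
  obtain ⟨c, hc, hcle, hcε⟩ := exists_isGLB_half_add_div_rpow hB hα
  refine ⟨c, hc, tendsto_order.2 ⟨fun a ha => ?_, fun a ha => ?_⟩⟩
  · obtain ⟨K, hK, hle⟩ := moment_le hA hB hα hcle
    have h2 : Filter.Tendsto (fun t : ℝ => (t ^ (α / (1 + α)))⁻¹) Filter.atTop (nhds 0) :=
      (tendsto_rpow_atTop (by positivity)).inv_tendsto_atTop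
    have h3 : Filter.Tendsto (fun t : ℝ => c - Real.log K * (t ^ (α / (1 + α)))⁻¹) Filter.atTop
        (nhds c) := by simpa using (h2.const_mul (Real.log K)).const_sub c
    filter_upwards [h3.eventually_const_lt ha, Filter.eventually_gt_atTop 0] with t h4 ht
    refine h4.trans_le ?_
    have hβ : 0 < t ^ (α / (1 + α)) := Real.rpow_pos_of_pos ht _
    have h5 := Real.log_le_log (moment_pos hA hB hα ht.le) (hle t ht)
    rw [Real.log_mul hK.ne' (Real.exp_pos _).ne', Real.log_exp] at h5
    rw [le_div_iff₀ hβ, sub_mul, inv_mul_cancel_right₀ hβ.ne']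
    linarith
  · obtain ⟨y, hy, hylt⟩ := hcε (a - c) (by linarith)
    obtain ⟨l, hl, hllt⟩ : ∃ l : ℝ, 1 < l ∧ l * y / 2 + B / y ^ α < a := by
      have h1 : Filter.Tendsto (fun l : ℝ => l * y / 2 + B / y ^ α) (nhdsWithin 1 (Set.Ioi 1))
          (nhds (1 * y / 2 + B / y ^ α)) :=
        (Continuous.tendsto (by fun_prop) 1).mono_left nhdsWithin_le_nhds
      have h2 := h1.eventually_lt_const (show 1 * y / 2 + B / y ^ α < a by linarith)
      obtain ⟨l, h3, h4⟩ := (h2.and self_mem_nhdsWithin).exists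
      exact ⟨l, h4, h3⟩
    have h1 : Filter.Tendsto (fun t : ℝ => l * y * t ^ (-(1 / (1 + α)))) Filter.atTop (nhds 0) := by
      simpa using (tendsto_rpow_neg_atTop (y := 1 / (1 + α)) (by positivity)).const_mul (l * y)
    filter_upwards [(tendsto_neg_log_moment_upper (A := A) (B := B) (y := y) (l := l) hα).eventually_lt_const hllt,
      h1.eventually_lt_const one_pos, Filter.eventually_gt_atTop 0] with t h2 h3 h4
    exact (neg_log_moment_le hA hB hα hy hl h4 h3).trans_lt h2

/-! ### From `Lᵖ` bounds to moment inequalities -/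

theorem isBoundedOnLp_two_szegoProjection (U : Set (ℂ × ℂ)) (σ : Measure (ℂ × ℂ)) :
    IsBoundedOnLp (szegoProjection U σ) 2 := by
  refine ⟨1, fun f _ => ?_⟩
  rw [ENNReal.coe_one, one_mul, ← Lp.enorm_def, ← Lp.enorm_def, enorm_le_iff_norm_le]
  exact Submodule.norm_starProjection_apply_le _ f

/-- The form in which boundedness is used: one constant serves all `n` and all radial weights. The
normalisation by `1` makes the test functions bounded, hence in every `Lᵖ` of the finite measure. -/
theorem exists_eLpNorm_pow_mul_const_le {A B α : ℝ} (hA : 0 ≤ A) (hB : 0 < B) (hα : 0 < α)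
    {p : ℝ≥0∞}
    (h : IsBoundedOnLp (szegoProjection (reinhardtDomain A B α) (surfaceMeasure A B α)) p) :
    ∃ C : ℝ≥0, ∀ (n : ℕ) (k : ℝ → ℝ) (c : ℝ), Measurable k →
      (∀ r ∈ Set.Ico (0 : ℝ) 1, r ^ n * |k r| ≤ 1) →
      c * moment A B α (2 * n) = ∫ w, ‖w.1‖ ^ (2 * n) * k ‖w.1‖ ∂surfaceMeasure A B α →
      eLpNorm (fun w : ℂ × ℂ => w.1 ^ n * (c : ℂ)) p (surfaceMeasure A B α) ≤
        C * eLpNorm (fun w : ℂ × ℂ => w.1 ^ n * (k ‖w.1‖ : ℂ)) p (surfaceMeasure A B α) := by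
  obtain ⟨C, hC⟩ := h
  refine ⟨C, fun n k c hk hk1 hc => ?_⟩
  have hm : moment A B α (2 * n) = ∫ w, ‖w.1‖ ^ (2 * n) ∂surfaceMeasure A B α := by
    refine integral_congr_ae (Filter.Eventually.of_forall fun w => ?_)
    simp only [← Real.rpow_natCast]
    push_cast
    rfl
  rw [hm] at hc
  have h1 := (memLp_pow_mul_radial hA hB hα n hk hk1 2).coeFn_toLp
  have h2 := hC (memLp_pow_mul_radial hA hB hα n hk hk1 2).toLp
    ((memLp_congr_ae h1).2 (memLp_pow_mul_radial hA hB hα n hk hk1 p))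
  rwa [eLpNorm_congr_ae h1, eLpNorm_congr_ae (szegoProjection_pow_mul_radial hA hB hα n hk hk1 hc)]
    at h2

theorem eLpNorm_pow_mul_radial {A B α : ℝ} (hA : 0 ≤ A) (hB : 0 < B) (hα : 0 < α) {p : ℝ≥0∞}
    (hp0 : p ≠ 0) (hp : p ≠ ⊤) (n : ℕ) {κ : ℝ → ℝ} (hκ : Measurable κ) {C : ℝ}
    (hC : ∀ r ∈ Set.Ico (0 : ℝ) 1, r ^ n * |κ r| ≤ C) :
    eLpNorm (fun w : ℂ × ℂ => w.1 ^ n * (κ ‖w.1‖ : ℂ)) p (surfaceMeasure A B α) =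
      ENNReal.ofReal ((∫ w, (‖w.1‖ ^ n * |κ ‖w.1‖|) ^ p.toReal ∂surfaceMeasure A B α) ^
        p.toReal⁻¹) := by
  rw [MemLp.eLpNorm_eq_integral_rpow_norm hp0 hp (memLp_pow_mul_radial hA hB hα n hκ hC p)]
  simp only [norm_mul, norm_pow, Complex.norm_real, Real.norm_eq_abs]

theorem surfaceMeasure_lt_norm_fst_pos {A B α : ℝ} (hA : 0 ≤ A) (hB : 0 < B) (hα : 0 < α) {ρ : ℝ}
    (hρ : 0 ≤ ρ) (hρ1 : ρ < 1) : 0 < surfaceMeasure A B α {w | ρ < ‖w.1‖} := by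
  have hx : 0 < 1 - ρ ^ 2 := by nlinarith
  have h := le_surfaceMeasure_annulus hA hB hα (x₁ := (1 - ρ ^ 2) / 4) (x₂ := (1 - ρ ^ 2) / 2)
    (by linarith) (by linarith) (by nlinarith)
  refine lt_of_lt_of_le (ENNReal.ofReal_pos.2 ?_) (h.trans (measure_mono fun w hw => ?_))
  · have := Real.pi_pos
    have : 0 < (1 - ρ ^ 2) / 2 - (1 - ρ ^ 2) / 4 := by linarith
    positivity
  · have h2 := hw.2
    have : ρ ^ 2 < ‖w.1‖ ^ 2 := by linarith
    exact (sq_lt_sq₀ hρ (norm_nonneg _)).1 this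

/-- Bernoulli's inequality. At this distance from the rim `|z₁|ⁿ` is still at least `1/2`, which
makes it harmless in both endpoint arguments. -/
theorem half_le_one_sub_inv_pow (n : ℕ) : (1 / 2 : ℝ) ≤ (1 - 1 / (2 * (n + 1))) ^ n := by
  have hn : (0 : ℝ) ≤ n := n.cast_nonneg
  have h1 : (1 : ℝ) / (2 * (n + 1)) ≤ 1 := by
    rw [div_le_one (by positivity)]; linarith
  have h := one_add_mul_le_pow (a := -(1 / (2 * (n + 1)) : ℝ)) (by linarith) n
  rw [← sub_eq_add_neg] at h
  refine le_trans ?_ h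
  have : (n : ℝ) * (1 / (2 * (n + 1))) ≤ 1 / 2 := by
    rw [mul_one_div, div_le_div_iff₀ (by positivity) (by norm_num)]
    linarith
  linarith

theorem one_sub_inv_two_mul_mem_Ico (n : ℕ) : (1 - 1 / (2 * (n + 1)) : ℝ) ∈ Set.Ico (0 : ℝ) 1 := by
  have hn : (0 : ℝ) ≤ n := n.cast_nonneg
  have h1 : (1 : ℝ) / (2 * (n + 1)) ≤ 1 := by
    rw [div_le_one (by positivity)]; linarith
  have h2 : (0 : ℝ) < 1 / (2 * (n + 1)) := by positivity
  constructor <;> linarith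

theorem tendsto_neg_log_moment_natCast_mul {A B α c : ℝ}
    (hc : Filter.Tendsto (fun t => -Real.log (moment A B α t) / t ^ (α / (1 + α)))
      Filter.atTop (nhds c)) {a : ℝ} (ha : 0 < a) :
    Filter.Tendsto (fun n : ℕ => -Real.log (moment A B α (a * n)) / (n : ℝ) ^ (α / (1 + α)))
      Filter.atTop (nhds (c * a ^ (α / (1 + α)))) := by
  have h1 : Filter.Tendsto (fun n : ℕ => a * (n : ℝ)) Filter.atTop Filter.atTop :=
    tendsto_natCast_atTop_atTop.const_mul_atTop ha
  refine ((hc.comp h1).mul_const (a ^ (α / (1 + α)))).congr fun n => ?_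
  have := (Real.rpow_pos_of_pos ha (α / (1 + α))).ne'
  rw [Function.comp_apply, Real.mul_rpow ha.le n.cast_nonneg, mul_comm (a ^ _), ← div_div,
    div_mul_cancel₀ _ this]

/-- The ratio of moments `M(n) / M(2n)` is unbounded. -/
theorem not_forall_moment_le_mul_moment {A B α : ℝ} (hA : 0 ≤ A) (hB : 0 < B) (hα : 0 < α) {K : ℝ}
    (hK : ∀ n : ℕ, moment A B α n ≤ K * moment A B α (2 * n)) : False := by
  obtain ⟨c, hc, hlim⟩ := exists_tendsto_neg_log_moment hA hB hα
  have hβ : 0 < α / (1 + α) := by positivity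
  have hK0 : 0 < K := by
    have h := (moment_pos hA hB hα (Nat.cast_nonneg 0)).trans_le (hK 0)
    exact pos_of_mul_pos_left h (moment_pos hA hB hα (by simp)).le
  have h1 := tendsto_neg_log_moment_natCast_mul hlim one_pos
  have h2 := tendsto_neg_log_moment_natCast_mul hlim two_pos
  have h3 : Filter.Tendsto (fun n : ℕ => Real.log K / (n : ℝ) ^ (α / (1 + α))) Filter.atTop
      (nhds 0) := tendsto_const_nhds.div_atTop
    ((tendsto_rpow_atTop hβ).comp tendsto_natCast_atTop_atTop)
  -- Logarithms divided by `n^β` give `c (2^β - 1) ≤ 0` in the limit.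
  have h4 := le_of_tendsto_of_tendsto (h2.sub h1) h3 (by
    filter_upwards [Filter.eventually_gt_atTop 0] with n hn
    have hn' : 0 < (n : ℝ) ^ (α / (1 + α)) := Real.rpow_pos_of_pos (by exact_mod_cast hn) _
    have hp2 := moment_pos hA hB hα (t := 2 * n) (by positivity)
    have h5 := Real.log_le_log (moment_pos hA hB hα n.cast_nonneg) (hK n)
    rw [Real.log_mul hK0.ne' hp2.ne'] at h5
    rw [← sub_div, one_mul]
    gcongr
    linarith)
  have h5 : (1 : ℝ) ^ (α / (1 + α)) < 2 ^ (α / (1 + α)) :=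
    Real.rpow_lt_rpow zero_le_one one_lt_two hβ
  nlinarith

/-- Strict concavity of `x^{1-β}` at the midpoint `1/2` of `1/P` and `1/Q`, which are distinct
because `P ≠ 2`. -/
theorem rpow_sub_one_add_rpow_sub_one_lt {β P Q : ℝ} (hβ0 : 0 < β) (hβ1 : β < 1) (hP : 0 < P)
    (hQ : 0 < Q) (hPQ : P⁻¹ + Q⁻¹ = 1) (hne : P ≠ 2) : P ^ (β - 1) + Q ^ (β - 1) < 2 ^ β := by
  have hconc := Real.strictConcaveOn_rpow (p := 1 - β) (by linarith) (by linarith)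
  have hne' : P⁻¹ ≠ Q⁻¹ := fun h => hne (by rw [← h] at hPQ; field_simp at hPQ; linarith)
  have h := hconc.2 (Set.mem_Ici.2 (inv_pos.2 hP).le) (Set.mem_Ici.2 (inv_pos.2 hQ).le) hne'
    (one_half_pos (α := ℝ)) (one_half_pos (α := ℝ)) (add_halves 1)
  simp only [smul_eq_mul] at h
  have h1 : ∀ x : ℝ, 0 < x → x⁻¹ ^ (1 - β) = x ^ (β - 1) := fun x hx => by
    rw [Real.inv_rpow hx.le, ← Real.rpow_neg hx.le, neg_sub]
  rw [← mul_add, ← mul_add, hPQ, mul_one, one_div, h1 P hP, h1 Q hQ, h1 2 two_pos,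
    Real.rpow_sub_one two_ne_zero] at h
  linarith

/-- The test function `(z₁/|z₁|)ⁿ` has modulus at most one and projects to `(M(n)/M(2n)) z₁ⁿ`.
Positive mass near the rim, where `|z₁|ⁿ ≥ 1/2`, then bounds `M(n)/M(2n)` by `2C`. -/
theorem not_isBoundedOnLp_top {A B α : ℝ} (hA : 0 ≤ A) (hB : 0 < B) (hα : 0 < α) :
    ¬IsBoundedOnLp (szegoProjection (reinhardtDomain A B α) (surfaceMeasure A B α)) ⊤ := by
  intro h
  obtain ⟨C, hC⟩ := exists_eLpNorm_pow_mul_const_le hA hB hα h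
  refine not_forall_moment_le_mul_moment hA hB hα (K := 2 * C) fun n => ?_
  have hM := moment_pos hA hB hα (t := 2 * n) (by positivity)
  have hM1 := moment_pos hA hB hα (t := n) (by positivity)
  have hk1 : ∀ r ∈ Set.Ico (0 : ℝ) 1, r ^ n * |(r ^ n)⁻¹| ≤ 1 := fun r hr => by
    rw [abs_of_nonneg (inv_nonneg.2 (pow_nonneg hr.1 n))]
    exact mul_inv_le_one
  have h1 := hC n (fun r => (r ^ n)⁻¹) (moment A B α n / moment A B α (2 * n)) (by fun_prop) hk1 (by
    rw [div_mul_cancel₀ _ hM.ne', moment]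
    refine integral_congr_ae (Filter.Eventually.of_forall fun w => ?_)
    simp only [Real.rpow_natCast]
    -- Where `|z₁|ⁿ = 0` the convention `0⁻¹ = 0` makes both integrands vanish.
    rcases eq_or_ne (‖w.1‖ ^ n) 0 with h0 | h0
    · rw [h0, two_mul, pow_add, h0]; simp
    · rw [two_mul, pow_add, mul_inv_cancel_right₀ h0])
  have h2 : eLpNorm (fun w : ℂ × ℂ => w.1 ^ n * (((‖w.1‖ ^ n)⁻¹ : ℝ) : ℂ)) ⊤
      (surfaceMeasure A B α) ≤ 1 := by
    rw [eLpNorm_exponent_top, ← ENNReal.ofReal_one]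
    refine eLpNormEssSup_le_of_ae_bound ?_
    filter_upwards [ae_surfaceMeasure_norm_fst_lt A B α] with w hw
    rw [norm_mul, norm_pow, Complex.norm_real]
    exact hk1 _ ⟨norm_nonneg _, hw⟩
  have h3 := h1.trans (mul_le_of_le_one_right' h2)
  rw [eLpNorm_exponent_top] at h3
  obtain ⟨hρ0, hρ1⟩ := one_sub_inv_two_mul_mem_Ico n
  set ρ : ℝ := 1 - 1 / (2 * (n + 1)) with hρ
  obtain ⟨w, hw1, hw2⟩ : ∃ w : ℂ × ℂ, ρ < ‖w.1‖ ∧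
      ‖w.1 ^ n * ((moment A B α n / moment A B α (2 * n) : ℝ) : ℂ)‖ₑ ≤ C := by
    by_contra! hcon
    refine (surfaceMeasure_lt_norm_fst_pos hA hB hα hρ0 hρ1).ne' (measure_mono_null ?_
      ((ae_le_eLpNormEssSup (f := fun w : ℂ × ℂ => w.1 ^ n *
        ((moment A B α n / moment A B α (2 * n) : ℝ) : ℂ))).mono fun w hw => hw.trans h3))
    exact fun w hw => not_le.2 (hcon w hw)
  have h4 : ‖w.1‖ ^ n * (moment A B α n / moment A B α (2 * n)) ≤ C := by
    have h5 : ‖w.1 ^ n * ((moment A B α n / moment A B α (2 * n) : ℝ) : ℂ)‖₊ ≤ C := by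
      exact_mod_cast hw2
    have h6 : ‖w.1 ^ n * ((moment A B α n / moment A B α (2 * n) : ℝ) : ℂ)‖ ≤ C := h5
    rwa [norm_mul, norm_pow, Complex.norm_real, Real.norm_of_nonneg (by positivity)] at h6
  have h5 : (1 / 2 : ℝ) ≤ ‖w.1‖ ^ n :=
    (half_le_one_sub_inv_pow n).trans (pow_le_pow_left₀ hρ0 hw1.le n)
  have h6 : 1 / 2 * (moment A B α n / moment A B α (2 * n)) ≤ C :=
    (mul_le_mul_of_nonneg_right h5 (by positivity)).trans h4
  rw [mul_div, div_le_iff₀ hM] at h6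
  linarith

/-- The test function `(z₁/|z₁|)ⁿ` is cut off to `E = {|z₁| > ρ}`, so its `L¹` norm is `σ(E)`. On
`E` one has `|z₁|ⁿ ≥ 1/2`, hence `c ≥ σ(E) / (2 M(2n))`; the projection has norm `c M(n)`, and
`σ(E)` cancels. -/
theorem not_isBoundedOnLp_one {A B α : ℝ} (hA : 0 ≤ A) (hB : 0 < B) (hα : 0 < α) :
    ¬IsBoundedOnLp (szegoProjection (reinhardtDomain A B α) (surfaceMeasure A B α)) 1 := by
  intro h
  have hfin := isFiniteMeasure_surfaceMeasure hA hB hα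
  obtain ⟨C, hC⟩ := exists_eLpNorm_pow_mul_const_le hA hB hα h
  refine not_forall_moment_le_mul_moment hA hB hα (K := 2 * C) fun n => ?_
  have hM := moment_pos hA hB hα (t := 2 * n) (by positivity)
  have hM1 := moment_pos hA hB hα (t := n) (by positivity)
  obtain ⟨hρ0, hρ1⟩ := one_sub_inv_two_mul_mem_Ico n
  have hhalf := half_le_one_sub_inv_pow n
  set ρ : ℝ := 1 - 1 / (2 * (n + 1)) with hρ
  set k : ℝ → ℝ := (Set.Ioi ρ).indicator fun r => (r ^ n)⁻¹ with hk
  have hkm : Measurable k := Measurable.indicator (by fun_prop) measurableSet_Ioi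
  set E : Set (ℂ × ℂ) := {w | ρ < ‖w.1‖} with hE
  have hEm : MeasurableSet E := measurableSet_lt measurable_const (by fun_prop)
  have hval : ∀ r, 0 ≤ r → r ^ n * |k r| = (Set.Ioi ρ).indicator 1 r := fun r hr => by
    by_cases hr' : r ∈ Set.Ioi ρ
    · have h0 : 0 < r := hρ0.trans_lt hr'
      rw [hk, Set.indicator_of_mem hr', Set.indicator_of_mem hr', Pi.one_apply,
        abs_of_pos (by positivity), mul_inv_cancel₀ (by positivity)]
    · rw [hk, Set.indicator_of_notMem hr', Set.indicator_of_notMem hr', abs_zero, mul_zero]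
  have hk1 : ∀ r ∈ Set.Ico (0 : ℝ) 1, r ^ n * |k r| ≤ 1 := fun r hr => by
    rw [hval r hr.1]
    exact Set.indicator_le_self' (fun _ _ => zero_le_one) r
  have hm : 0 < (surfaceMeasure A B α).real E :=
    ENNReal.toReal_pos (surfaceMeasure_lt_norm_fst_pos hA hB hα hρ0 hρ1).ne' (measure_ne_top _ _)
  set c := (∫ w, ‖w.1‖ ^ (2 * n) * k ‖w.1‖ ∂surfaceMeasure A B α) / moment A B α (2 * n) with hc
  have hint : Integrable (fun w : ℂ × ℂ => ‖w.1‖ ^ (2 * n) * k ‖w.1‖) (surfaceMeasure A B α) := by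
    refine Integrable.of_bound (Measurable.aestronglyMeasurable (by fun_prop)) 1 ?_
    filter_upwards [ae_surfaceMeasure_norm_fst_lt A B α] with w hw
    rw [norm_mul, norm_pow, norm_norm, two_mul, pow_add, mul_assoc]
    exact mul_le_one₀ (pow_le_one₀ (norm_nonneg _) hw.le) (by positivity)
      (hk1 _ ⟨norm_nonneg _, hw⟩)
  have hcle : 1 / 2 * (surfaceMeasure A B α).real E ≤
      ∫ w, ‖w.1‖ ^ (2 * n) * k ‖w.1‖ ∂surfaceMeasure A B α := by
    have : 1 / 2 * (surfaceMeasure A B α).real E =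
        ∫ w, E.indicator (fun _ => (1 / 2 : ℝ)) w ∂surfaceMeasure A B α := by
      rw [integral_indicator_const _ hEm, smul_eq_mul, mul_comm]
    rw [this]
    refine integral_mono ((integrable_const _).indicator hEm) hint fun w => ?_
    by_cases hw : w ∈ E
    · have hw' : ρ < ‖w.1‖ := hw
      have h0 : 0 < ‖w.1‖ := hρ0.trans_lt hw'
      simp only [hk]
      rw [Set.indicator_of_mem hw, Set.indicator_of_mem (Set.mem_Ioi.2 hw'), two_mul, pow_add,
        mul_inv_cancel_right₀ (by positivity)]
      exact hhalf.trans (pow_le_pow_left₀ hρ0 hw'.le n)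
    · simp only [hk]
      rw [Set.indicator_of_notMem hw, Set.indicator_of_notMem (s := Set.Ioi ρ) hw, mul_zero]
  have hc0 : 0 ≤ c := div_nonneg (le_trans (by positivity) hcle) hM.le
  have h1 := hC n k c hkm hk1 (div_mul_cancel₀ _ hM.ne')
  rw [eLpNorm_pow_mul_radial hA hB hα one_ne_zero ENNReal.one_ne_top n hkm hk1,
    eLpNorm_pow_mul_radial hA hB hα one_ne_zero ENNReal.one_ne_top n (κ := fun _ => c)
      measurable_const (C := |c|) fun r hr =>
        mul_le_of_le_one_left (abs_nonneg _) (pow_le_one₀ hr.1 hr.2.le)] at h1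
  simp only [ENNReal.toReal_one, Real.rpow_one, inv_one, abs_of_nonneg hc0] at h1
  have h2 : ∫ w : ℂ × ℂ, ‖w.1‖ ^ n * |k ‖w.1‖| ∂surfaceMeasure A B α =
      (surfaceMeasure A B α).real E := by
    rw [← integral_indicator_one hEm]
    refine integral_congr_ae (Filter.Eventually.of_forall fun w => ?_)
    exact hval _ (norm_nonneg _)
  have h3 : ∫ w : ℂ × ℂ, ‖w.1‖ ^ n * c ∂surfaceMeasure A B α = moment A B α n * c := by
    rw [integral_mul_const, moment]
    simp only [Real.rpow_natCast]
  rw [h2, h3, ← ENNReal.ofReal_coe_nnreal, ← ENNReal.ofReal_mul C.coe_nonneg,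
    ENNReal.ofReal_le_ofReal_iff (by positivity)] at h1
  have h4 : 1 / 2 * (surfaceMeasure A B α).real E / moment A B α (2 * n) ≤ c := by
    rw [hc]; gcongr
  have h5 := (mul_le_mul_of_nonneg_left h4 hM1.le).trans h1
  rw [mul_div, div_le_iff₀ hM] at h5
  nlinarith

/-- The weight is the equality case of Hölder's inequality against `z₁ⁿ`: the test function has
modulus `|z₁|^{n/(P-1)}`. Both its `P`-th power integral and its pairing with `z₁ⁿ` equal `M(Qn)`.
-/
theorem not_isBoundedOnLp_of_one_lt {A B α : ℝ} (hA : 0 ≤ A) (hB : 0 < B) (hα : 0 < α) {p : ℝ≥0∞}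
    (hp1 : 1 < p) (hp : p ≠ ⊤) (hp2 : p ≠ 2) :
    ¬IsBoundedOnLp (szegoProjection (reinhardtDomain A B α) (surfaceMeasure A B α)) p := by
  intro h
  obtain ⟨C, hC⟩ := exists_eLpNorm_pow_mul_const_le hA hB hα h
  have hp0 : p ≠ 0 := (zero_lt_one.trans hp1).ne'
  set P := p.toReal with hPdef
  have hP1 : 1 < P := by
    rw [hPdef, ← ENNReal.toReal_one]
    exact (ENNReal.toReal_lt_toReal ENNReal.one_ne_top hp).2 hp1
  have hP2 : P ≠ 2 := fun h => hp2 (by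
    rw [← ENNReal.ofReal_toReal hp, ← hPdef, h]; simp)
  set Q := P / (P - 1) with hQdef
  have hPpos : 0 < P := by linarith
  have hP1' : 0 < P - 1 := by linarith
  have hQpos : 0 < Q := div_pos hPpos hP1'
  have hPQ : P⁻¹ + Q⁻¹ = 1 := by
    rw [hQdef, inv_div]; field_simp; ring
  have hβ : 0 < α / (1 + α) := by positivity
  have hβ1 : α / (1 + α) < 1 := by rw [div_lt_one (by positivity)]; linarith
  have key : ∀ n : ℕ, 0 < n → moment A B α (Q * n) / moment A B α (2 * n) *
      moment A B α (P * n) ^ P⁻¹ ≤ C * moment A B α (Q * n) ^ P⁻¹ := by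
    intro n hn
    have hn' : (0 : ℝ) < n := by exact_mod_cast hn
    have hM := moment_pos hA hB hα (t := 2 * n) (by positivity)
    have hMQ := moment_pos hA hB hα (t := Q * n) (by positivity)
    have hMP := moment_pos hA hB hα (t := P * n) (by positivity)
    have hs : 0 < (n : ℝ) / (P - 1) := by positivity
    -- At `r = 0` both sides vanish only because `n > 0`; this is why `key` excludes `n = 0`.
    have hpow : ∀ r : ℝ, 0 ≤ r → r ^ n * r ^ ((n : ℝ) / (P - 1) - n) = r ^ ((n : ℝ) / (P - 1)) :=
      fun r hr => by
      rcases hr.eq_or_lt with rfl | hr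
      · rw [zero_pow hn.ne', zero_mul, Real.zero_rpow hs.ne']
      · rw [← Real.rpow_natCast, ← Real.rpow_add hr]
        congr 1
        ring
    have habs : ∀ r : ℝ, 0 ≤ r → r ^ n * |r ^ ((n : ℝ) / (P - 1) - n)| =
        r ^ ((n : ℝ) / (P - 1)) := fun r hr => by
      rw [abs_of_nonneg (Real.rpow_nonneg hr _), hpow r hr]
    have hk1 : ∀ r ∈ Set.Ico (0 : ℝ) 1, r ^ n * |r ^ ((n : ℝ) / (P - 1) - n)| ≤ 1 := fun r hr => by
      rw [habs r hr.1]
      exact Real.rpow_le_one hr.1 hr.2.le hs.le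
    set c := moment A B α (Q * n) / moment A B α (2 * n) with hc
    have hc0 : 0 ≤ c := div_nonneg hMQ.le hM.le
    have h1 := hC n (fun r => r ^ ((n : ℝ) / (P - 1) - n)) c (by fun_prop) hk1 (by
      rw [hc, div_mul_cancel₀ _ hM.ne', moment]
      refine integral_congr_ae (Filter.Eventually.of_forall fun w => ?_)
      simp only
      rw [two_mul, pow_add, mul_assoc, hpow _ (norm_nonneg _), ← Real.rpow_natCast,
        ← Real.rpow_add_of_nonneg (norm_nonneg _) hn'.le hs.le]
      congr 1
      rw [hQdef]
      field_simp
      ring)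
    rw [eLpNorm_pow_mul_radial hA hB hα hp0 hp n (by fun_prop) hk1,
      eLpNorm_pow_mul_radial hA hB hα hp0 hp n (κ := fun _ => c)
        measurable_const (C := |c|) fun r hr =>
          mul_le_of_le_one_left (abs_nonneg _) (pow_le_one₀ hr.1 hr.2.le)] at h1
    have h2 : ∫ w : ℂ × ℂ, (‖w.1‖ ^ n * |c|) ^ P ∂surfaceMeasure A B α =
        moment A B α (P * n) * c ^ P := by
      rw [moment, ← integral_mul_const]
      refine integral_congr_ae (Filter.Eventually.of_forall fun w => ?_)
      simp only
      rw [abs_of_nonneg hc0, Real.mul_rpow (by positivity) hc0, ← Real.rpow_natCast,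
        ← Real.rpow_mul (norm_nonneg _), mul_comm (n : ℝ)]
    have h3 : ∫ w : ℂ × ℂ, (‖w.1‖ ^ n * |‖w.1‖ ^ ((n : ℝ) / (P - 1) - n)|) ^ P
        ∂surfaceMeasure A B α = moment A B α (Q * n) := by
      refine integral_congr_ae (Filter.Eventually.of_forall fun w => ?_)
      simp only
      rw [habs _ (norm_nonneg _), ← Real.rpow_mul (norm_nonneg _)]
      congr 1
      rw [hQdef]
      ring
    rw [h2, h3, ← ENNReal.ofReal_coe_nnreal, ← ENNReal.ofReal_mul C.coe_nonneg,
      ENNReal.ofReal_le_ofReal_iff (by positivity), Real.mul_rpow hMP.le (by positivity),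
      Real.rpow_rpow_inv hc0 hPpos.ne', mul_comm] at h1
    exact h1
  obtain ⟨c, hc, hlim⟩ := exists_tendsto_neg_log_moment hA hB hα
  have hC0 : 0 < (C : ℝ) := by
    have h1 := key 1 one_pos
    have hM := moment_pos hA hB hα (t := 2 * (1 : ℕ)) (by positivity)
    have hMQ := moment_pos hA hB hα (t := Q * (1 : ℕ)) (by positivity)
    have hMP := moment_pos hA hB hα (t := P * (1 : ℕ)) (by positivity)
    have h2 := lt_of_lt_of_le (by positivity) h1
    exact pos_of_mul_pos_left h2 (by positivity)
  have h1 := (tendsto_neg_log_moment_natCast_mul hlim hPpos).mul_const P⁻¹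
  have h2 := tendsto_neg_log_moment_natCast_mul hlim two_pos
  have h3 := (tendsto_neg_log_moment_natCast_mul hlim hQpos).mul_const Q⁻¹
  have h4 : Filter.Tendsto (fun n : ℕ => Real.log C / (n : ℝ) ^ (α / (1 + α))) Filter.atTop
      (nhds 0) := tendsto_const_nhds.div_atTop
    ((tendsto_rpow_atTop hβ).comp tendsto_natCast_atTop_atTop)
  -- Since `1 - 1/P = 1/Q`, `key` says `M(Qn)^{1/Q} M(Pn)^{1/P} ≤ C M(2n)`. In the logarithmic limit
  -- this reads `c (2^β - P^{β-1} - Q^{β-1}) ≤ 0`.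
  have h5 := le_of_tendsto_of_tendsto ((h2.sub h1).sub h3) h4 (by
    filter_upwards [Filter.eventually_gt_atTop 0] with n hn
    have hn' : 0 < (n : ℝ) ^ (α / (1 + α)) := Real.rpow_pos_of_pos (by exact_mod_cast hn) _
    have hM := moment_pos hA hB hα (t := 2 * n) (by positivity)
    have hMQ := moment_pos hA hB hα (t := Q * n) (by positivity)
    have hMP := moment_pos hA hB hα (t := P * n) (by positivity)
    have h5 := Real.log_le_log (by positivity) (key n hn)
    rw [Real.log_mul (by positivity) (by positivity), Real.log_div hMQ.ne' hM.ne',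
      Real.log_mul hC0.ne' (by positivity), Real.log_rpow hMP, Real.log_rpow hMQ] at h5
    have hQ' : Q⁻¹ = 1 - P⁻¹ := by linarith
    rw [div_mul_eq_mul_div, div_mul_eq_mul_div, ← sub_div, ← sub_div, hQ']
    gcongr
    linarith)
  have h6 := rpow_sub_one_add_rpow_sub_one_lt hβ hβ1 hPpos hQpos hPQ hP2
  rw [Real.rpow_sub_one hPpos.ne', Real.rpow_sub_one hQpos.ne'] at h6
  have h7 : 0 < c * (2 ^ (α / (1 + α)) - (P ^ (α / (1 + α)) / P + Q ^ (α / (1 + α)) / Q)) :=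
    mul_pos hc (by linarith)
  rw [div_eq_mul_inv (P ^ _), div_eq_mul_inv (Q ^ _)] at h7
  linarith

end SzegoIrregularity

end

open SzegoIrregularity in
theorem mainTheorem1 (A B α : ℝ) (hA : 0 ≤ A) (hB : 0 < B) (hα : 0 < α) :
    (IsConnected (reinhardtDomain A B α) ∧
      Bornology.IsBounded (reinhardtDomain A B α) ∧
      IsCompleteReinhardt (reinhardtDomain A B α) ∧
      IsPseudoconvex (reinhardtDomain A B α)) ∧
    ∀ p : ENNReal, 1 ≤ p →
      (IsBoundedOnLp (szegoProjection (reinhardtDomain A B α) (surfaceMeasure A B α)) p ↔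
        p = 2) := by
  have hR := isCompleteReinhardt_reinhardtDomain hA hB hα
  refine ⟨⟨hR.isConnected ⟨0, zero_mem_reinhardtDomain A B α⟩,
    isBounded_reinhardtDomain hA hB hα, hR, isPseudoconvex_reinhardtDomain hA hB hα⟩,
    fun p hp => ⟨fun h => ?_, ?_⟩⟩
  · by_contra hp2
    rcases hp.eq_or_lt with rfl | hp1
    · exact not_isBoundedOnLp_one hA hB hα h
    rcases eq_or_ne p ⊤ with rfl | hpt
    · exact not_isBoundedOnLp_top hA hB hα h
    · exact not_isBoundedOnLp_of_one_lt hA hB hα hp1 hpt hp2 h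
  · rintro rfl
    exact isBoundedOnLp_two_szegoProjection _ _
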